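/- Let $\mathbb F$ be a field of any characteristic, and let $L$ and $H$ be Lie algebras over $\mathbb F$ (of arbitrary dimension) whose universal enveloping algebras $U(L)$ and $U(H)$ are isomorphic as associative $\mathbb F$-algebras. Write $\gamma_1(L)=L$, $\gamma_{n+1}(L)=[\gamma_n(L),L]$ for the lower central series, $L'=[L,L]$ and $L''=(L')'$. A Lie algebra $L$ is called residually nilpotent if $\bigcap_{n\ge 1}\gamma_n(L)=0$, and nilpotent if $\gamma_n(L)=0$ for some $n$; the nilpotence class of a nilpotent $L$ is the least integer $c\ge 0$ with $\gamma_{c+1}(L)=0$. Then: 1. $L$ is residually nilpotent if and only if $H$ is residually nilpotent. 2. $L$ is nilpotent if and only if $H$ is nilpotent. 3. If $L$ is nilpotent, then $L$ and $H$ have the same nilpotence class. 4. If $L$ is nilpotent, then the minimal number of generators of $L$ (the least cardinality, possibly infinite, of a subset generating $L$ as a Lie algebra) equals that of $H$. 5. If $L$ is a finitely generated free nilpotent Lie algebra, that is, $L\cong \mathcal L/\gamma_{c+1}(\mathcal L)$ for some integer $c\ge 0$ and some free Lie algebra $\mathcal L$ on a finite set, then $L\cong H$ as Lie algebras. 6.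 $L'/L''\cong H'/H''$ as Lie algebras. 7. $L'$ is residually nilpotent if and only if $H'$ is residually nilpotent. 8. If $L$ is finite-dimensional, then $L$ is solvable if and only if $H$ is solvable. -/

import Mathlib

universe u v

/-- A Lie algebra `L` is residually nilpotent if the intersection of the terms of its lower
central series is zero. -/
def LieIsResiduallyNilpotent (F L : Type*) [Field F] [LieRing L] [LieAlgebra F L] : Prop :=
  ⨅ n : ℕ, LieModule.lowerCentralSeries F L L n = ⊥

/-- The derived subalgebra `L' = [L, L]`. -/
abbrev lieDerived (F L : Type*) [Field F] [LieRing L] [LieAlgebra F L] : LieIdeal F L :=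
  LieAlgebra.derivedSeries F L 1

/-- The quotient `L' / L''`, as a Lie algebra; here `L'' = (L')'`. -/
abbrev LieDerivedQuotient (F L : Type*) [Field F] [LieRing L] [LieAlgebra F L] : Type _ :=
  lieDerived F L ⧸ lieDerived F (lieDerived F L)

/-- The minimal number of generators of `L` as a Lie algebra: the least cardinality of a subset
of `L` that is contained in no proper Lie subalgebra. -/
noncomputable def lieGeneratorRank (F : Type*) (L : Type u) [Field F] [LieRing L]
    [LieAlgebra F L] : Cardinal.{u} :=
  sInf {κ | ∃ S : Set L, LieSubalgebra.lieSpan F L S = ⊤ ∧ Cardinal.mk S = κ}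

/-- The free nilpotent Lie algebra of class `c` on `X`: the free Lie algebra on `X` modulo the
term `γ_{c+1}` of its lower central series (which is term number `c` when counting from zero). -/
abbrev FreeNilpotentLieAlgebra (F X : Type*) [Field F] (c : ℕ) : Type _ :=
  FreeLieAlgebra F X ⧸
    (LieModule.lowerCentralSeries F (FreeLieAlgebra F X) (FreeLieAlgebra F X) c :
      LieIdeal F (FreeLieAlgebra F X))

/-- `L` is a finitely generated free nilpotent Lie algebra: it is isomorphic to the free nilpotent
Lie algebra of some class `c` on some finite number `n` of generators. -/
def IsFGFreeNilpotent (F L : Type*) [Field F] [LieRing L] [LieAlgebra F L] : Prop :=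
  ∃ n c : ℕ, Nonempty (L ≃ₗ⁅F⁆ FreeNilpotentLieAlgebra F (Fin n) c)

/-! Each invariant of `L` is read off from the ideal `envIdeal N` = ι(N)U(L) attached to a Lie ideal
`N`. Two choices of `N` are preserved by isomorphisms. For `N = ⊤` it is the augmentation ideal ω.
An algebra isomorphism need not preserve the augmentation, but it does after composition with an
automorphism x ↦ x - χ(x) of U(L), χ a character of `L`. For `N = L'` it is the two-sided ideal
generated by all commutators of U(L).

The tool is the Poincaré–Birkhoff–Witt theorem, proved with a weight on the basis. If the basis is
adapted to the filtration L ⊇ N ⊇ [N,N] ⊇ [N,[N,N]] ⊇ ..., rewriting into ordered monomials never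
lowers weight, so `envIdeal N ^ n` has only monomials of weight at least n. Together with a
reduction to the quotients of `L` by the terms of the filtration, this shows that `N` is residually
nilpotent iff the powers of `envIdeal N` intersect in 0 (`forall_mem_centralFiltration_iff`), and
that L ∩ ω^n = γ_n(L) for n ≥ 1 (`ι_mem_envIdeal_pow_iff`). The first equivalence settles residual
nilpotence of `L` and of `L'`.

A second use of PBW gives N ∩ (`envIdeal N` · ω) = [N,N], so N/[N,N] is `envIdeal N` modulo
`envIdeal N` · ω. For `N = L'` this is L'/L'', where both Lie algebras are abelian and a linear
isomorphism suffices; for `N = ⊤` it is L/L', whose dimension is the number of generators in the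
nilpotent case.

For nilpotence, the (c+1)-fold commutators of elements of ω equal ι(γ_{c+1}(L)) modulo ω^{c+2}. If
γ_{c+1}(L) = 0, transport gives γ_{c+1}(H) = γ_{c+2}(H), and residual nilpotence of `H` makes this
term zero.

Polynomial growth of U(L) recovers dim L. If `L` is free nilpotent of finite rank, `H` has the same
class bound and generator bound, hence is a quotient of `L` of equal finite dimension. Finally, a
finite-dimensional `L` is solvable iff ω contains no nonzero subspace I with I ≤ I * I. -/

namespace PBW

/-! ### Action of a Lie algebra on polynomials in an ordered basis, with degrees and weights -/

open Finsupp Module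

variable {F L I : Type*} [Field F] [LieRing L] [LieAlgebra F L]

@[elab_as_elim]
theorem basis_induction {V : Type*} [AddCommGroup V] [Module F V] (b : Basis I F V) {p : V → Prop}
    (x : V) (zero : p 0) (coe : ∀ i, p (b i)) (add : ∀ x y, p x → p y → p (x + y))
    (smul : ∀ (c : F) x, p x → p (c • x)) : p x := by
  have hx : x ∈ Submodule.span F (Set.range b) := by simp [b.span_eq]
  induction hx using Submodule.span_induction with
  | zero => exact zero
  | add x y _ _ hx hy => exact add x y hx hy
  | smul c x _ hx => exact smul c x hx
  | mem x hx =>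
    obtain ⟨i, rfl⟩ := hx
    exact coe i

/-- The monomial `z_M` indexed by a multiset. -/
noncomputable abbrev mono (F : Type*) [Field F] {I : Type*} (M : Multiset I) : Multiset I →₀ F :=
  single M 1

/-- Polynomials of degree at most `d` whose monomials have weight at least `e`. -/
def filt (F : Type*) [Field F] {I : Type*} (w : I → ℕ) (d e : ℕ) :
    Submodule F (Multiset I →₀ F) :=
  supported F F {Q | Q.card ≤ d ∧ e ≤ (Q.map w).sum}

theorem mono_mem_filt {w : I → ℕ} {d e : ℕ} {Q : Multiset I} :
    mono F Q ∈ filt F w d e ↔ Q.card ≤ d ∧ e ≤ (Q.map w).sum := by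
  simp [filt, mem_supported]

theorem filt_mono {w : I → ℕ} {d e d' e' : ℕ} (h : d ≤ d') (h' : e' ≤ e) :
    filt F w d e ≤ filt F w d' e' :=
  supported_mono fun _ hQ => ⟨hQ.1.trans h, h'.trans hQ.2⟩

theorem mem_filt_zero (p : Multiset I →₀ F) (w : I → ℕ) (e : ℕ)
    (hp : ∀ Q ∈ p.support, e ≤ (Q.map w).sum) : ∃ d, p ∈ filt F w d e := by
  refine ⟨p.support.sup Multiset.card, fun Q hQ => ⟨?_, hp Q hQ⟩⟩
  exact Finset.le_sup (f := Multiset.card) hQ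

theorem filt_induction {w : I → ℕ} {d e : ℕ} {S : Submodule F (Multiset I →₀ F)}
    (h : ∀ Q : Multiset I, Q.card ≤ d → e ≤ (Q.map w).sum → mono F Q ∈ S) :
    filt F w d e ≤ S := by
  rw [filt, supported_eq_span_single, Submodule.span_le]
  rintro _ ⟨Q, hQ, rfl⟩
  exact h Q hQ.1 hQ.2

/-- A weight on the index set of a basis for which the bracket is superadditive. -/
def IsWeight (b : Basis I F L) (w : I → ℕ) : Prop :=
  ∀ i j, ⁅b i, b j⁆ ∈ Submodule.span F (b '' {l | w i + w j ≤ w l})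

theorem isWeight_zero (b : Basis I F L) : IsWeight b 0 := by
  intro i j
  simp [b.span_eq]

/-- `T` is arbitrary so that the same estimate serves the approximations, inside the induction that
establishes `h` for them, and later the action itself. -/
theorem map_filt_le {w : I → ℕ} {d e a : ℕ} {T : L →ₗ[F] (Multiset I →₀ F) →ₗ[F] (Multiset I →₀ F)}
    {b : Basis I F L}
    (h : ∀ i (M : Multiset I), M.card ≤ d → T (b i) (mono F M) - mono F (i ::ₘ M) ∈
      filt F w M.card (w i + (M.map w).sum))
    {x : L} (hx : x ∈ Submodule.span F (b '' {l | a ≤ w l}))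
    {p : Multiset I →₀ F} (hp : p ∈ filt F w d e) : T x p ∈ filt F w (d + 1) (a + e) := by
  induction hx using Submodule.span_induction with
  | zero => simp
  | add x y _ _ hx hy => simpa using add_mem hx hy
  | smul c x _ hx => simpa using Submodule.smul_mem _ c hx
  | mem x hx =>
    obtain ⟨i, hi, rfl⟩ := hx
    have : filt F w d e ≤ (filt F w (d + 1) (a + e)).comap (T (b i)) := by
      refine filt_induction fun Q hQ hQ' => ?_
      rw [Submodule.mem_comap, ← sub_add_cancel (T (b i) (mono F Q)) (mono F (i ::ₘ Q))]
      have hi' : a ≤ w i := hi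
      refine add_mem (filt_mono (by omega) (by omega) (h i Q hQ)) ?_
      rw [mono_mem_filt]
      simp; omega
    exact this hp

variable [LinearOrder I]

/-- Approximations to the action of a Lie algebra on polynomials in a basis: the `n`-th one is
correct on polynomials of degree at most `n`. -/
noncomputable def approxAction (b : Basis I F L) :
    ℕ → L →ₗ[F] (Multiset I →₀ F) →ₗ[F] (Multiset I →₀ F)
  | 0 => b.constr F fun i => linearCombination F fun M => mono F (i ::ₘ M)
  | n + 1 => b.constr F fun i => linearCombination F fun M =>
      match M.sort (· ≤ ·) with
      | [] => mono F (i ::ₘ M)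
      | k :: N =>
        if i ≤ k then mono F (i ::ₘ M)
        -- With M = k ∪ N and k < i, the formula is forced by x_i x_k = x_k x_i + [x_i, x_k]: the
        -- leading term z_i z_N of x_i z_N contributes x_k z_i z_N = z_i z_M because k is minimal,
        -- and only the lower-degree remainder needs a recursive call.
        else mono F (i ::ₘ M) +
          approxAction b n (b k)
            (approxAction b n (b i) (mono F (N : Multiset I)) - mono F (i ::ₘ (N : Multiset I))) +
          approxAction b n ⁅b i, b k⁆ (mono F (N : Multiset I))

theorem eq_zero_or_eq_min_cons (M : Multiset I) :
    M = 0 ∨ ∃ k N, M = k ::ₘ N ∧ ∀ j ∈ N, k ≤ j := by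
  rcases h : M.sort (· ≤ ·) with _ | ⟨k, N⟩
  · left
    rw [← M.sort_eq (· ≤ ·), h]; rfl
  · right
    refine ⟨k, N, ?_, ?_⟩
    · rw [← M.sort_eq (· ≤ ·), h]; rfl
    · have := M.pairwise_sort (· ≤ ·)
      rw [h, List.pairwise_cons] at this
      simpa using this.1

theorem exists_min_cons {i : I} {M : Multiset I} (h : ¬ ∀ j ∈ M, i ≤ j) :
    ∃ k N, M = k ::ₘ N ∧ (∀ j ∈ N, k ≤ j) ∧ k < i := by
  rcases eq_zero_or_eq_min_cons M with rfl | ⟨k, N, rfl, hk⟩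
  · simp at h
  · refine ⟨k, N, rfl, hk, ?_⟩
    by_contra hik
    push Not at hik
    exact h fun j hj => by
      rcases Multiset.mem_cons.1 hj with rfl | hj
      · exact hik
      · exact hik.trans (hk j hj)

theorem approxAction_of_le (b : Basis I F L) (n : ℕ) {i : I} {M : Multiset I}
    (h : ∀ j ∈ M, i ≤ j) : approxAction b n (b i) (mono F M) = mono F (i ::ₘ M) := by
  rcases n with _ | n
  · simp [approxAction]
  · rcases eq_zero_or_eq_min_cons M with rfl | ⟨k, N, rfl, hk⟩
    · simp [approxAction]
    · have hik : i ≤ k := h k (by simp)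
      simp [approxAction, Multiset.sort_cons (r := (· ≤ ·)) k N hk, hik]

theorem approxAction_succ (b : Basis I F L) (n : ℕ) {i k : I} {N : Multiset I}
    (h : ∀ j ∈ N, k ≤ j) (hk : k < i) :
    approxAction b (n + 1) (b i) (mono F (k ::ₘ N)) = mono F (i ::ₘ k ::ₘ N) +
      approxAction b n (b k) (approxAction b n (b i) (mono F N) - mono F (i ::ₘ N)) +
      approxAction b n ⁅b i, b k⁆ (mono F N) := by
  have : ((i :: N.sort (· ≤ ·) : List I) : Multiset I) = i ::ₘ N := by
    rw [← Multiset.cons_coe, Multiset.sort_eq]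
  simp [approxAction, Multiset.sort_cons (r := (· ≤ ·)) k N h, hk.not_ge, Multiset.sort_eq, this]

/-- Both correction terms act on polynomials of degree at most |N| = |M| - 1 and raise degree by at
most one. Superadditivity of `w` on brackets keeps their weight at least that of i ∪ M. Weight zero
gives the classical degree estimate. -/
theorem approxAction_sub_mem {b : Basis I F L} {w : I → ℕ} (hw : IsWeight b w) (n : ℕ) (i : I)
    (M : Multiset I) : approxAction b n (b i) (mono F M) - mono F (i ::ₘ M) ∈
      filt F w M.card (w i + (M.map w).sum) := by
  induction n generalizing i M with
  | zero => simp [approxAction]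
  | succ n ih =>
    by_cases h : ∀ j ∈ M, i ≤ j
    · simp [approxAction_of_le b (n + 1) h]
    · obtain ⟨k, N, rfl, hk, hki⟩ := exists_min_cons h
      · rw [approxAction_succ b n hk hki, add_assoc, add_sub_cancel_left]
        have h1 := map_filt_le (T := approxAction b n) (b := b) (d := N.card) (a := w k)
          (fun i M _ => ih i M) (x := b k) (Submodule.subset_span ⟨k, le_refl (w k), rfl⟩) (ih i N)
        have h2 := map_filt_le (T := approxAction b n) (b := b) (d := N.card) (w := w)
          (e := (N.map w).sum) (fun i M _ => ih i M) (hw i k)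
          (mono_mem_filt.2 ⟨le_rfl, le_rfl⟩ : mono F N ∈ _)
        refine add_mem (filt_mono (by simp) ?_ h1) (filt_mono (by simp) ?_ h2) <;>
        · simp; omega

/-- On a monomial of degree at most n + 1 the recursion calls the previous approximation only in
degree at most n, where stability is known by induction. -/
theorem approxAction_stable (b : Basis I F L) (n : ℕ) (x : L) {p : Multiset I →₀ F}
    (hp : p ∈ filt F (0 : I → ℕ) n 0) : approxAction b (n + 1) x p = approxAction b n x p := by
  induction n generalizing x p with
  | zero =>
    have h0 : ∀ m, approxAction b m x (mono F 0) =
        b.constr F (fun i => mono F (i ::ₘ 0)) x := by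
      intro m
      induction x using basis_induction b with
      | zero => simp
      | coe i => rw [approxAction_of_le b m (by simp)]; simp
      | add x y hx hy => simp_all
      | smul c x hx => simp_all
    have : filt F (0 : I → ℕ) 0 0 ≤
        LinearMap.eqLocus (approxAction b 1 x) (approxAction b 0 x) := by
      refine filt_induction fun Q hQ _ => ?_
      obtain rfl : Q = 0 := by simpa using hQ
      exact (h0 1).trans (h0 0).symm
    exact this hp
  | succ n ih =>
    have : filt F (0 : I → ℕ) (n + 1) 0 ≤
        LinearMap.eqLocus (approxAction b (n + 2) x) (approxAction b (n + 1) x) := by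
      refine filt_induction fun Q hQ _ => ?_
      rw [LinearMap.mem_eqLocus]
      induction x using basis_induction b with
      | zero => simp
      | add x y hx hy => simp_all
      | smul c x hx => simp_all
      | coe i =>
        by_cases h : ∀ j ∈ Q, i ≤ j
        · rw [approxAction_of_le b _ h, approxAction_of_le b _ h]
        obtain ⟨k, N, rfl, hk, hki⟩ := exists_min_cons h
        have hN : N.card ≤ n := by simpa using hQ
        have hN' : mono F N ∈ filt F (0 : I → ℕ) n 0 := mono_mem_filt.2 ⟨hN, Nat.zero_le _⟩
        rw [approxAction_succ b _ hk hki, approxAction_succ b _ hk hki, ih _ hN', ih _ hN', ih]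
        exact filt_mono hN (by simp) (approxAction_sub_mem (isWeight_zero b) n i N)
    exact this hp

/-- The action of a Lie algebra on polynomials in the elements of an ordered basis. -/
noncomputable def action (b : Basis I F L) :
    L →ₗ[F] (Multiset I →₀ F) →ₗ[F] (Multiset I →₀ F) :=
  b.constr F fun i => linearCombination F fun M => approxAction b M.card (b i) (mono F M)

theorem action_mono (b : Basis I F L) (x : L) (M : Multiset I) :
    action b x (mono F M) = approxAction b M.card x (mono F M) := by
  induction x using basis_induction b with
  | zero => simp
  | add x y hx hy => simp_all
  | smul c x hx => simp_all
  | coe i => simp [action]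

theorem action_eq (b : Basis I F L) (n : ℕ) (x : L) {p : Multiset I →₀ F}
    (hp : p ∈ filt F (0 : I → ℕ) n 0) : action b x p = approxAction b n x p := by
  have : filt F (0 : I → ℕ) n 0 ≤ LinearMap.eqLocus (action b x) (approxAction b n x) := by
    refine filt_induction fun Q hQ _ => ?_
    rw [LinearMap.mem_eqLocus, action_mono]
    clear hp
    induction n, hQ using Nat.le_induction with
    | base => rfl
    | succ n hn ih =>
      rw [approxAction_stable b n x (mono_mem_filt.2 ⟨hn, Nat.zero_le _⟩)]
      exact ih
  exact this hp

theorem action_of_le (b : Basis I F L) {i : I} {M : Multiset I}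
    (h : ∀ j ∈ M, i ≤ j) : action b (b i) (mono F M) = mono F (i ::ₘ M) := by
  rw [action_mono, approxAction_of_le b _ h]

theorem action_sub_mem {b : Basis I F L} {w : I → ℕ} (hw : IsWeight b w) (i : I)
    (M : Multiset I) : action b (b i) (mono F M) - mono F (i ::ₘ M) ∈
      filt F w M.card (w i + (M.map w).sum) := by
  rw [action_mono]
  exact approxAction_sub_mem hw _ i M

theorem action_mem {b : Basis I F L} {w : I → ℕ} (hw : IsWeight b w) {d e a : ℕ}
    {x : L} (hx : x ∈ Submodule.span F (b '' {l | a ≤ w l}))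
    {p : Multiset I →₀ F} (hp : p ∈ filt F w d e) : action b x p ∈ filt F w (d + 1) (a + e) :=
  map_filt_le (fun i M _ => action_sub_mem hw i M) hx hp

/-- This is the defining recursion read backwards: when k is minimal, z_k z_N is the action of `b k`
on z_N. -/
theorem action_action_of_le (b : Basis I F L) {i k : I} {N : Multiset I}
    (h : ∀ j ∈ N, k ≤ j) (hk : k ≤ i) :
    action b (b i) (action b (b k) (mono F N)) =
      action b (b k) (action b (b i) (mono F N)) + action b ⁅b i, b k⁆ (mono F N) := by
  rcases hk.eq_or_lt with rfl | hk
  · simp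
  have hN := mono_mem_filt (F := F) (w := (0 : I → ℕ)).2 ⟨le_refl N.card, Nat.zero_le _⟩
  have hq := action_sub_mem (isWeight_zero b) i N
  have hq' := filt_mono le_rfl (Nat.zero_le _) hq
  rw [action_of_le b h, action_mono, Multiset.card_cons, approxAction_succ b _ h hk,
    ← action_eq b _ _ hN, ← action_eq b _ _ hN, ← action_eq b _ _ hq', map_sub,
    action_of_le b (M := i ::ₘ N), Multiset.cons_swap k i]
  · abel
  · simpa [hk.le] using h

/-- Induction on degree. If the smaller of i, j is minimal for M, the relation is the definition.
Otherwise write z_M = x_k z_N with k smaller than both, move x_k to the left by the relations known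
in lower degree, and compare using the Jacobi identity. -/
theorem action_lie_aux (b : Basis I F L) (M : Multiset I) (n : ℕ) (hM : M.card ≤ n) (x y : L) :
    action b x (action b y (mono F M)) =
      action b y (action b x (mono F M)) + action b ⁅x, y⁆ (mono F M) := by
  induction n using Nat.strong_induction_on generalizing M x y with
  | _ n ih =>
  have key : ∀ i j : I, j ≤ i → action b (b i) (action b (b j) (mono F M)) =
      action b (b j) (action b (b i) (mono F M)) + action b ⁅b i, b j⁆ (mono F M) := by
    intro i j hij
    by_cases h : ∀ l ∈ M, j ≤ l
    · exact action_action_of_le b h hij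
    obtain ⟨k, N, rfl, hk, hkj⟩ := exists_min_cons h
    have hN : N.card < n := by simp at hM; omega
    have ihN := fun x y => ih N.card hN N le_rfl x y
    have ihp : ∀ x y, ∀ p ∈ filt F (0 : I → ℕ) N.card 0, action b x (action b y p) =
        action b y (action b x p) + action b ⁅x, y⁆ p := by
      intro x y p hp
      have : filt F (0 : I → ℕ) N.card 0 ≤ LinearMap.eqLocus (action b x ∘ₗ action b y)
          (action b y ∘ₗ action b x + action b ⁅x, y⁆) :=
        filt_induction fun Q hQ _ => ih N.card hN Q hQ x y
      exact this hp
    -- The vector x_j z_N has degree |N| + 1, too large for the induction hypothesis. It splits into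
    -- z_j z_N, for which k is still minimal, and a remainder of degree at most |N|.
    have comm : ∀ i j : I, k ≤ i → k < j →
        action b (b i) (action b (b k) (action b (b j) (mono F N))) =
        action b (b k) (action b (b i) (action b (b j) (mono F N))) +
          action b ⁅b i, b k⁆ (action b (b j) (mono F N)) := by
      intro i j hki hkj
      have hq := filt_mono le_rfl (Nat.zero_le _) (action_sub_mem (isWeight_zero b) j N)
      have h1 := ihp (b i) (b k) _ hq
      have h2 : action b (b i) (action b (b k) (mono F (j ::ₘ N))) =
          action b (b k) (action b (b i) (mono F (j ::ₘ N))) +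
            action b ⁅b i, b k⁆ (mono F (j ::ₘ N)) :=
        action_action_of_le b (by simpa [hkj.le] using hk) hki
      simp only [map_sub] at h1
      rw [h2, sub_eq_iff_eq_add] at h1
      rw [h1]
      abel
    rw [← action_of_le b hk, ihN (b j) (b k), ihN (b i) (b k), map_add, map_add,
      comm i j (hkj.le.trans hij) hkj, comm j i hkj.le (hkj.trans_le hij),
      ihN (b i) (b j), map_add, ihN (b i) ⁅b j, b k⁆, ihN (b j) ⁅b i, b k⁆, ihN ⁅b i, b j⁆ (b k),
      lie_lie (b i) (b j) (b k), map_sub, LinearMap.sub_apply]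
    abel
  induction x using basis_induction b with
  | zero => simp
  | add x x' hx hx' => simp only [map_add, LinearMap.add_apply, add_lie, hx, hx']; abel
  | smul c x hx => simp only [map_smul, LinearMap.smul_apply, smul_lie, hx, smul_add]
  | coe i =>
    induction y using basis_induction b with
    | zero => simp
    | add x x' hx hx' => simp only [map_add, LinearMap.add_apply, lie_add, hx, hx']; abel
    | smul c x hx => simp only [map_smul, LinearMap.smul_apply, lie_smul, hx, smul_add]
    | coe j =>
      rcases le_total j i with h | h
      · exact key i j h
      · rw [key j i h, ← lie_skew (b j) (b i)]
        simp only [map_neg, LinearMap.neg_apply]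
        abel

theorem action_lie (b : Basis I F L) (x y : L) (p : Multiset I →₀ F) :
    action b ⁅x, y⁆ p = action b x (action b y p) - action b y (action b x p) := by
  induction p using Finsupp.induction_linear with
  | zero => simp
  | add p q hp hq => simp only [map_add, hp, hq]; abel
  | single M c =>
    have := action_lie_aux b M _ le_rfl x y
    rw [← mul_one c, ← smul_eq_mul, ← smul_single]
    simp only [map_smul, this, ← smul_sub]
    simp

end PBW

/-! ### Generation of the enveloping algebra by the Lie algebra -/

namespace UniversalEnvelopingAlgebra

attribute [local instance] LieRing.ofAssociativeRing

variable {F L : Type*} [Field F] [LieRing L] [LieAlgebra F L]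

/-- By the universal property `ι` factors through the subalgebra it generates; the lift followed by
the inclusion agrees with the identity on generators, so it is the identity. -/
theorem adjoin_range_ι :
    Algebra.adjoin F (Set.range (ι F : L → UniversalEnvelopingAlgebra F L)) = ⊤ := by
  set S := Algebra.adjoin F (Set.range (ι F : L → UniversalEnvelopingAlgebra F L))
  let f : L →ₗ⁅F⁆ S :=
    { toFun := fun x => ⟨ι F x, Algebra.subset_adjoin ⟨x, rfl⟩⟩
      map_add' := fun x y => Subtype.ext (map_add _ x y)
      map_smul' := fun c x => Subtype.ext (map_smul _ c x)
      map_lie' := fun {x y} => Subtype.ext (LieHom.map_lie _ x y) }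
  have h : S.val.comp (lift F f) = AlgHom.id F _ := by
    ext x
    have := lift_ι_apply F f x
    simp only [LieHom.comp_apply, AlgHom.coe_toLieHom, AlgHom.comp_apply, AlgHom.id_apply]
    rw [this]
    rfl
  rw [eq_top_iff]
  intro u _
  have := DFunLike.congr_fun h u
  simp only [AlgHom.comp_apply, AlgHom.id_apply] at this
  rw [← this]
  exact (lift F f u).2

theorem submodule_eq_top {S : Submodule F (UniversalEnvelopingAlgebra F L)} (h1 : 1 ∈ S)
    (h : ∀ x : L, ∀ u ∈ S, ι F x * u ∈ S) : S = ⊤ := by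
  have key : ∀ a : UniversalEnvelopingAlgebra F L, ∀ u ∈ S, a * u ∈ S := by
    intro a
    have ha : a ∈ Algebra.adjoin F (Set.range (ι F : L → UniversalEnvelopingAlgebra F L)) := by
      simp [adjoin_range_ι]
    induction ha using Algebra.adjoin_induction with
    | mem a ha =>
      obtain ⟨x, rfl⟩ := ha
      exact h x
    | algebraMap c => exact fun u hu => by simpa [Algebra.smul_def] using S.smul_mem c hu
    | add a b _ _ ha hb => exact fun u hu => by simpa [add_mul] using add_mem (ha u hu) (hb u hu)
    | mul a b _ _ ha hb => exact fun u hu => by simpa [mul_assoc] using ha _ (hb u hu)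
  exact eq_top_iff.2 fun a _ => by simpa using key a 1 h1

@[elab_as_elim]
theorem induction_left {p : UniversalEnvelopingAlgebra F L → Prop}
    (u : UniversalEnvelopingAlgebra F L) (one : p 1) (ι_mul : ∀ x u, p u → p (ι F x * u))
    (add : ∀ u v, p u → p v → p (u + v)) (smul : ∀ (c : F) u, p u → p (c • u)) : p u := by
  have : (⟨⟨⟨{u | p u}, fun {a b} => add a b⟩, by simpa using smul 0 1 one⟩, smul⟩ :
      Submodule F (UniversalEnvelopingAlgebra F L)) = ⊤ :=
    submodule_eq_top one ι_mul
  exact (this ▸ Submodule.mem_top : u ∈ (⟨⟨⟨{u | p u}, _⟩, _⟩, _⟩ :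
      Submodule F (UniversalEnvelopingAlgebra F L)))

end UniversalEnvelopingAlgebra

/-! ### Ordered monomials and the Poincaré–Birkhoff–Witt isomorphism -/

namespace PBW

open Finsupp Module UniversalEnvelopingAlgebra

attribute [local instance] LieRing.ofAssociativeRing

variable {F L I : Type*} [Field F] [LieRing L] [LieAlgebra F L] [LinearOrder I]

/-- The representation of a Lie algebra on polynomials. -/
noncomputable def actionHom (b : Basis I F L) : L →ₗ⁅F⁆ Module.End F (Multiset I →₀ F) where
  toFun x := action b x
  map_add' x y := map_add _ x y
  map_smul' c x := map_smul _ c x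
  map_lie' {x y} := LinearMap.ext fun p => by
    rw [action_lie, LieRing.of_associative_ring_bracket]
    rfl

/-- The ordered monomial in the enveloping algebra. -/
noncomputable def sortedProd (b : Basis I F L) (M : Multiset I) : UniversalEnvelopingAlgebra F L :=
  ((M.sort (· ≤ ·)).map fun i => ι F (b i)).prod

theorem sortedProd_cons (b : Basis I F L) {k : I} {M : Multiset I} (h : ∀ j ∈ M, k ≤ j) :
    sortedProd b (k ::ₘ M) = ι F (b k) * sortedProd b M := by
  simp [sortedProd, Multiset.sort_cons (r := (· ≤ ·)) k M h]

/-- The linear map sending a monomial to the ordered monomial in the enveloping algebra. -/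
noncomputable def ofPoly (b : Basis I F L) :
    (Multiset I →₀ F) →ₗ[F] UniversalEnvelopingAlgebra F L :=
  linearCombination F (sortedProd b)

theorem ofPoly_mono (b : Basis I F L) (M : Multiset I) :
    ofPoly b (mono F M) = sortedProd b M := by
  simp [ofPoly]

/-- This makes `ofPoly` a module map, so it inverts evaluation at 1. The induction on degree follows
the recursion that defines the action. -/
theorem ofPoly_action (b : Basis I F L) (x : L) (p : Multiset I →₀ F) :
    ofPoly b (action b x p) = ι F x * ofPoly b p := by
  obtain ⟨d, hd⟩ := mem_filt_zero p 0 0 (fun Q _ => Nat.zero_le _)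
  induction d using Nat.strong_induction_on generalizing x p with
  | _ n ih =>
  have : filt F (0 : I → ℕ) n 0 ≤ LinearMap.eqLocus (ofPoly b ∘ₗ action b x)
      (LinearMap.mulLeft F (ι F x) ∘ₗ ofPoly b) := by
    refine filt_induction fun Q hQ _ => ?_
    rw [LinearMap.mem_eqLocus]
    simp only [LinearMap.comp_apply, LinearMap.mulLeft_apply]
    clear hd p
    induction x using basis_induction b with
    | zero => simp
    | add x y hx hy => simp_all [add_mul]
    | smul c x hx => simp_all
    | coe i =>
      by_cases h : ∀ l ∈ Q, i ≤ l
      · rw [action_of_le b h, ofPoly_mono, ofPoly_mono, sortedProd_cons b h]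
      obtain ⟨k, N, rfl, hk, hki⟩ := exists_min_cons h
      have hN : N.card < n := by simp at hQ; omega
      have hNN := mono_mem_filt (F := F) (w := (0 : I → ℕ)).2 ⟨le_refl N.card, Nat.zero_le _⟩
      have hq := filt_mono le_rfl (Nat.zero_le _) (action_sub_mem (isWeight_zero b) i N)
      have hik : ∀ l ∈ i ::ₘ N, k ≤ l := by simpa [hki.le] using hk
      -- Left multiplication by `b k` is controlled on x_i z_N in two pieces: on z_i z_N because k
      -- is minimal, and on the remainder by the induction hypothesis.
      have h1 : ofPoly b (action b (b k) (action b (b i) (mono F N))) =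
          ι F (b k) * ofPoly b (action b (b i) (mono F N)) := by
        have h2 := ih N.card hN (b k) _ hq
        rw [map_sub, map_sub, map_sub, mul_sub, action_of_le b hik, ofPoly_mono, ofPoly_mono,
          sortedProd_cons b hik] at h2
        exact sub_left_injective h2
      rw [← action_of_le b hk, action_action_of_le b hk hki.le, map_add, h1,
        ih N.card hN (b i) _ hNN, ih N.card hN _ _ hNN, action_of_le b hk, ofPoly_mono,
        ofPoly_mono, sortedProd_cons b hk, LieHom.map_lie, LieRing.of_associative_ring_bracket]
      noncomm_ring
  exact this hd

/-- The linear map from the enveloping algebra to polynomials given by acting on `1`. -/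
noncomputable def toPoly (b : Basis I F L) :
    UniversalEnvelopingAlgebra F L →ₗ[F] (Multiset I →₀ F) :=
  (LinearMap.applyₗ (mono F 0)) ∘ₗ (lift F (actionHom b)).toLinearMap

theorem toPoly_one (b : Basis I F L) : toPoly b 1 = mono F 0 := by
  simp [toPoly]

theorem toPoly_ι_mul (b : Basis I F L) (x : L) (u : UniversalEnvelopingAlgebra F L) :
    toPoly b (ι F x * u) = action b x (toPoly b u) := by
  have := lift_ι_apply F (actionHom b) x
  simp only [toPoly, LinearMap.comp_apply, LinearMap.applyₗ_apply_apply, AlgHom.toLinearMap_apply,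
    map_mul, Module.End.mul_apply, this]
  rfl

theorem toPoly_sortedProd (b : Basis I F L) (M : Multiset I) :
    toPoly b (sortedProd b M) = mono F M := by
  induction hn : M.card generalizing M with
  | zero =>
    obtain rfl : M = 0 := by simpa using hn
    simp [sortedProd, toPoly_one]
  | succ n ih =>
    rcases eq_zero_or_eq_min_cons M with rfl | ⟨k, N, rfl, hk⟩
    · simp at hn
    · rw [sortedProd_cons b hk, toPoly_ι_mul, ih N (by simpa using hn), action_of_le b hk]

theorem ofPoly_toPoly (b : Basis I F L) (u : UniversalEnvelopingAlgebra F L) :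
    ofPoly b (toPoly b u) = u := by
  induction u using induction_left with
  | one => simp [toPoly_one, ofPoly_mono, sortedProd]
  | ι_mul x u hu => rw [toPoly_ι_mul, ofPoly_action, hu]
  | add u v hu hv => simp [hu, hv]
  | smul c u hu => simp [hu]

theorem toPoly_ofPoly (b : Basis I F L) (p : Multiset I →₀ F) :
    toPoly b (ofPoly b p) = p := by
  induction p using Finsupp.induction_linear with
  | zero => simp
  | add p q hp hq => simp [hp, hq]
  | single M c =>
    rw [← mul_one c, ← smul_eq_mul, ← smul_single, map_smul, map_smul, ofPoly_mono,
      toPoly_sortedProd]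

/-- The **Poincaré–Birkhoff–Witt theorem**: the enveloping algebra is linearly isomorphic to the
space of polynomials in an ordered basis, via ordered monomials. -/
noncomputable def pbw (b : Basis I F L) :
    UniversalEnvelopingAlgebra F L ≃ₗ[F] (Multiset I →₀ F) :=
  LinearEquiv.ofLinearMap (toPoly b) (ofPoly b) (LinearMap.ext (toPoly_ofPoly b))
    (LinearMap.ext (ofPoly_toPoly b))

theorem pbw_one (b : Basis I F L) : pbw b 1 = mono F 0 := toPoly_one b

theorem pbw_ι_mul (b : Basis I F L) (x : L) (u : UniversalEnvelopingAlgebra F L) :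
    pbw b (ι F x * u) = action b x (pbw b u) := toPoly_ι_mul b x u

theorem pbw_symm_mono (b : Basis I F L) (M : Multiset I) :
    (pbw b).symm (mono F M) = sortedProd b M := ofPoly_mono b M

theorem pbw_ι (b : Basis I F L) (x : L) :
    pbw b (ι F x) = (b.repr x).mapDomain fun i => {i} := by
  rw [← mul_one (ι F x), pbw_ι_mul, pbw_one]
  induction x using basis_induction b with
  | zero => simp
  | add x y hx hy => simp [hx, hy, mapDomain_add]
  | smul c x hx => simp [hx, mapDomain_smul]
  | coe i => rw [action_of_le b (by simp)]; simp [mapDomain_single]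

theorem pbw_ι_apply (b : Basis I F L) (x : L) (i : I) : pbw b (ι F x) {i} = b.repr x i := by
  rw [pbw_ι, mapDomain_apply fun i j h => Multiset.singleton_inj.1 h]

end PBW

theorem UniversalEnvelopingAlgebra.ι_injective {F L : Type*} [Field F] [LieRing L]
    [LieAlgebra F L] : Function.Injective (ι F : L → UniversalEnvelopingAlgebra F L) := by
  classical
  let b := Module.Basis.ofVectorSpace F L
  let _ : LinearOrder (Module.Basis.ofVectorSpaceIndex F L) := linearOrderOfSTO WellOrderingRel
  intro x y h
  refine b.repr.injective (Finsupp.ext fun i => ?_)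
  rw [← PBW.pbw_ι_apply, ← PBW.pbw_ι_apply, h]

/-! ### Ideals of the enveloping algebra generated by Lie ideals -/

namespace UniversalEnvelopingAlgebra

attribute [local instance] LieRing.ofAssociativeRing

variable {F L : Type*} [Field F] [LieRing L] [LieAlgebra F L]

/-- The right ideal (two-sided, in fact) of the enveloping algebra generated by a Lie ideal. -/
noncomputable def envIdeal (N : LieIdeal F L) : Submodule F (UniversalEnvelopingAlgebra F L) :=
  N.toSubmodule.map (ι F : L →ₗ⁅F⁆ UniversalEnvelopingAlgebra F L).toLinearMap * ⊤

theorem ι_mul_mem_envIdeal {N : LieIdeal F L} {x : L} (hx : x ∈ N)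
    (u : UniversalEnvelopingAlgebra F L) : ι F x * u ∈ envIdeal N :=
  Submodule.mul_mem_mul ⟨x, hx, rfl⟩ Submodule.mem_top

theorem ι_mem_envIdeal {N : LieIdeal F L} {x : L} (hx : x ∈ N) : ι F x ∈ envIdeal N := by
  simpa using ι_mul_mem_envIdeal hx 1

theorem envIdeal_le {N : LieIdeal F L} {S : Submodule F (UniversalEnvelopingAlgebra F L)} :
    envIdeal N ≤ S ↔ ∀ x ∈ N, ∀ u, ι F x * u ∈ S := by
  refine ⟨fun h x hx u => h (ι_mul_mem_envIdeal hx u), fun h => Submodule.mul_le.2 ?_⟩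
  rintro _ ⟨x, hx, rfl⟩ u -
  exact h x hx u

theorem envIdeal_mono {N K : LieIdeal F L} (h : N ≤ K) : envIdeal N ≤ envIdeal K :=
  envIdeal_le.2 fun _ hx u => ι_mul_mem_envIdeal (h hx) u

theorem mul_mem_envIdeal_right {N : LieIdeal F L} {a : UniversalEnvelopingAlgebra F L}
    (ha : a ∈ envIdeal N) (u : UniversalEnvelopingAlgebra F L) : a * u ∈ envIdeal N := by
  have : envIdeal N ≤ (envIdeal N).comap (LinearMap.mulRight F u) :=
    envIdeal_le.2 fun x hx v => by
      rw [Submodule.mem_comap, LinearMap.mulRight_apply, mul_assoc]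
      exact ι_mul_mem_envIdeal hx _
  exact this ha

theorem ι_mul_ι (x y : L) : ι F x * ι F y = ι F y * ι F x + ι F ⁅x, y⁆ := by
  rw [LieHom.map_lie, LieRing.of_associative_ring_bracket]
  abel

theorem mul_mem_envIdeal_left {N : LieIdeal F L} {a : UniversalEnvelopingAlgebra F L}
    (u : UniversalEnvelopingAlgebra F L) (ha : a ∈ envIdeal N) : u * a ∈ envIdeal N := by
  induction u using induction_left with
  | one => simpa using ha
  | add u v hu hv => simpa [add_mul] using add_mem hu hv
  | smul c u hu => simpa using Submodule.smul_mem _ c hu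
  | ι_mul y u hu =>
    rw [mul_assoc]
    have : envIdeal N ≤ (envIdeal N).comap (LinearMap.mulLeft F (ι F y)) :=
      envIdeal_le.2 fun x hx v => by
        rw [Submodule.mem_comap, LinearMap.mulLeft_apply, ← mul_assoc, ι_mul_ι, add_mul, mul_assoc]
        exact add_mem (ι_mul_mem_envIdeal hx _) (ι_mul_mem_envIdeal (N.lie_mem hx) _)
    exact this hu

/-- The algebra homomorphism of enveloping algebras induced by a Lie algebra homomorphism. -/
noncomputable def map {L' : Type*} [LieRing L'] [LieAlgebra F L'] (f : L →ₗ⁅F⁆ L') :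
    UniversalEnvelopingAlgebra F L →ₐ[F] UniversalEnvelopingAlgebra F L' :=
  lift F ((ι F).comp f)

theorem map_ι {L' : Type*} [LieRing L'] [LieAlgebra F L'] (f : L →ₗ⁅F⁆ L') (x : L) :
    map f (ι F x) = ι F (f x) :=
  lift_ι_apply F _ x

theorem map_envIdeal_le {L' : Type*} [LieRing L'] [LieAlgebra F L'] (f : L →ₗ⁅F⁆ L')
    {N : LieIdeal F L} {N' : LieIdeal F L'} (h : ∀ x ∈ N, f x ∈ N') :
    (envIdeal N).map (map f).toLinearMap ≤ envIdeal N' :=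
  Submodule.map_le_iff_le_comap.2 <| envIdeal_le.2 fun x hx u => by
    rw [Submodule.mem_comap, AlgHom.toLinearMap_apply, map_mul, map_ι]
    exact ι_mul_mem_envIdeal (h x hx) _

theorem map_mem_envIdeal_pow {L' : Type*} [LieRing L'] [LieAlgebra F L'] (f : L →ₗ⁅F⁆ L')
    {N : LieIdeal F L} {N' : LieIdeal F L'} (h : ∀ x ∈ N, f x ∈ N') {n : ℕ}
    {u : UniversalEnvelopingAlgebra F L} (hu : u ∈ envIdeal N ^ n) :
    map f u ∈ envIdeal N' ^ n := by
  have h1 : map f u ∈ (envIdeal N ^ n).map (map f).toLinearMap := ⟨u, hu, rfl⟩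
  rw [Submodule.map_pow] at h1
  exact pow_le_pow_left' (map_envIdeal_le f h) n h1

end UniversalEnvelopingAlgebra

/-! ### The central filtration of a Lie ideal and bases adapted to it -/

/-- The lower central series of a Lie ideal `N` of `L`, as ideals of `L`, starting with
`L` in degree zero and `N` in degree one. -/
def LieIdeal.centralFiltration {F L : Type*} [Field F] [LieRing L] [LieAlgebra F L]
    (N : LieIdeal F L) : ℕ → LieIdeal F L
  | 0 => ⊤
  | 1 => N
  | k + 2 => ⁅N, centralFiltration N (k + 1)⁆

namespace LieIdeal

variable {F L : Type*} [Field F] [LieRing L] [LieAlgebra F L] (N : LieIdeal F L)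

theorem centralFiltration_succ_le (k : ℕ) :
    N.centralFiltration (k + 1) ≤ N.centralFiltration k := by
  rcases k with _ | k
  · exact le_top
  · exact LieSubmodule.lie_le_right _ _

theorem centralFiltration_antitone : Antitone N.centralFiltration :=
  antitone_nat_of_succ_le N.centralFiltration_succ_le

theorem lie_centralFiltration_le (k : ℕ) :
    ⁅N, N.centralFiltration k⁆ ≤ N.centralFiltration (k + 1) := by
  rcases k with _ | k
  · exact LieSubmodule.lie_le_left _ _
  · exact le_rfl

/-- Induction on i: for a generator [a, c] of the i-th term with a in N, the Jacobi identity
replaces [[a, c], y] by [a, [c, y]] and [c, [a, y]], both covered by smaller i. -/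
theorem lie_mem_centralFiltration {i j : ℕ} {x y : L} (hx : x ∈ N.centralFiltration i)
    (hy : y ∈ N.centralFiltration j) : ⁅x, y⁆ ∈ N.centralFiltration (i + j) := by
  induction i using Nat.strong_induction_on generalizing x y j with
  | _ i ih =>
  match i with
  | 0 => simpa using LieSubmodule.lie_mem _ hy
  | 1 =>
    rw [add_comm]
    exact N.lie_centralFiltration_le j (LieSubmodule.lie_mem_lie hx hy)
  | i + 2 =>
    have : x ∈ Submodule.span F {m | ∃ a ∈ N, ∃ c ∈ N.centralFiltration (i + 1), ⁅a, c⁆ = m} := by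
      rw [← LieSubmodule.lieIdeal_oper_eq_linear_span']
      exact hx
    clear hx
    induction this using Submodule.span_induction with
    | zero => simp
    | add x x' _ _ hx hx' => simpa using add_mem hx hx'
    | smul c x _ hx => simpa using Submodule.smul_mem _ c hx
    | mem x h =>
      obtain ⟨a, ha, c, hc, rfl⟩ := h
      rw [lie_lie]
      refine sub_mem ?_ ?_
      · have h1 := ih (i + 1) (by omega) hc hy
        have h2 := N.lie_centralFiltration_le _ (LieSubmodule.lie_mem_lie ha h1)
        rwa [show i + 2 + j = i + 1 + j + 1 by omega]
      · have h1 := N.lie_centralFiltration_le _ (LieSubmodule.lie_mem_lie ha hy)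
        have h2 := ih (i + 1) (by omega) hc h1
        rwa [show i + 2 + j = i + 1 + (j + 1) by omega]

end LieIdeal

/-- A basis is built upwards from V c = 0, extending a basis of each term to one of the next larger
term. The weight of a basis vector is the last index at which it still lies in the filtration; it is
finite because V c = 0. No finiteness of dimension is needed. -/
theorem exists_basis_adapted {F E : Type*} [Field F] [AddCommGroup E] [Module F E]
    (V : ℕ → Submodule F E) (hV : Antitone V) (h0 : V 0 = ⊤) {c : ℕ} (hc : V c = ⊥) :
    ∃ (T : Set E) (b : Module.Basis T F E) (w : T → ℕ),
      ∀ k, V k = Submodule.span F (b '' {i | k ≤ w i}) := by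
  classical
  have key : ∀ m, m ≤ c → ∃ T : Set E, LinearIndepOn F id T ∧ T ⊆ V (c - m) ∧
      ∀ k, c ≤ k + m → V k = Submodule.span F (T ∩ V k) := by
    intro m hm
    induction m with
    | zero =>
      refine ⟨∅, linearIndepOn_empty F id, by simp, fun k hk => ?_⟩
      simpa [hc] using hV (show c ≤ k by omega)
    | succ m ih =>
      obtain ⟨T, hT, hTV, hspan⟩ := ih (by omega)
      have hsub : T ⊆ V (c - (m + 1)) := hTV.trans (hV (by omega))
      refine ⟨hT.extend hsub, hT.linearIndepOn_extend hsub, hT.extend_subset hsub, fun k hk => ?_⟩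
      rcases Nat.lt_or_ge (k + m) c with h | h
      · obtain rfl : k = c - (m + 1) := by omega
        rw [Set.inter_eq_left.2 (hT.extend_subset hsub), hT.span_extend_eq_span, Submodule.span_eq]
      · refine le_antisymm ?_ (Submodule.span_le.2 Set.inter_subset_right)
        conv_lhs => rw [hspan k h]
        exact Submodule.span_mono (Set.inter_subset_inter_left _ (hT.subset_extend hsub))
  obtain ⟨T, hT, -, hspan⟩ := key c le_rfl
  have htop : ⊤ ≤ Submodule.span F (Set.range fun i : T => (i : E)) := by
    have := hspan 0 (by omega)
    rw [h0] at this
    rw [this, Subtype.range_coe]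
    exact Submodule.span_mono Set.inter_subset_left
  let b := Module.Basis.mk (v := fun i : T => (i : E)) hT htop
  have hb : ∀ i, b i = i := fun i => Module.Basis.mk_apply _ _ i
  have hlt : ∀ (i : T) k, (i : E) ∈ V k → k ≤ c := by
    intro i k hi
    by_contra hk
    have := hV (show c ≤ k by omega) hi
    rw [hc, Submodule.mem_bot] at this
    exact b.ne_zero i ((hb i).trans this)
  let w : T → ℕ := fun i => Nat.findGreatest (fun k => (i : E) ∈ V k) c
  have hw : ∀ (i : T) k, k ≤ w i ↔ (i : E) ∈ V k := by
    intro i k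
    refine ⟨fun h => ?_, fun h => Nat.le_findGreatest (hlt i k h) h⟩
    have : (i : E) ∈ V (w i) := Nat.findGreatest_spec (P := fun k => (i : E) ∈ V k) (m := 0)
      (Nat.zero_le _) (by simp [h0])
    exact hV h this
  refine ⟨T, b, w, fun k => ?_⟩
  have hset : b '' {i | k ≤ w i} = T ∩ V k := by
    ext x
    constructor
    · rintro ⟨i, hi, rfl⟩
      rw [hb]
      exact ⟨i.2, (hw i k).1 hi⟩
    · rintro ⟨hx, hx'⟩
      exact ⟨⟨x, hx⟩, (hw _ k).2 hx', hb _⟩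
  rw [hset]
  rcases le_total k c with h | h
  · exact hspan k (by omega)
  · exact hspan k (by omega)

/-! ### Powers of `envIdeal N` in terms of weights -/

namespace PBW

open Finsupp Module UniversalEnvelopingAlgebra

variable {F L I : Type*} [Field F] [LieRing L] [LieAlgebra F L]

theorem isWeight_of_centralFiltration {N : LieIdeal F L} {b : Basis I F L} {w : I → ℕ}
    (h : ∀ k, (N.centralFiltration k).toSubmodule = Submodule.span F (b '' {i | k ≤ w i})) :
    IsWeight b w := by
  have hb : ∀ i, b i ∈ N.centralFiltration (w i) := fun i => by
    rw [← LieSubmodule.mem_toSubmodule, h]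
    exact Submodule.subset_span ⟨i, le_refl (w i), rfl⟩
  intro i j
  rw [← h]
  exact N.lie_mem_centralFiltration (hb i) (hb j)

/-- Polynomials all of whose monomials have weight at least `e`. -/
def weightFilt (F : Type*) [Field F] (w : I → ℕ) (e : ℕ) : Submodule F (Multiset I →₀ F) :=
  supported F F {Q | e ≤ (Q.map w).sum}

variable [LinearOrder I]

theorem pbw_ι_mul_mem {b : Basis I F L} {w : I → ℕ} (hw : IsWeight b w) {a e : ℕ} {x : L}
    (hx : x ∈ Submodule.span F (b '' {i | a ≤ w i})) {v : UniversalEnvelopingAlgebra F L}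
    (hv : pbw b v ∈ weightFilt F w e) : pbw b (ι F x * v) ∈ weightFilt F w (a + e) := by
  obtain ⟨d, hd⟩ := mem_filt_zero (pbw b v) w e hv
  rw [pbw_ι_mul]
  exact supported_mono (fun Q hQ => hQ.2) (action_mem hw hx hd)

theorem pbw_mul_mem {b : Basis I F L} {w : I → ℕ} (hw : IsWeight b w) {e : ℕ}
    (u : UniversalEnvelopingAlgebra F L) {v : UniversalEnvelopingAlgebra F L}
    (hv : pbw b v ∈ weightFilt F w e) : pbw b (u * v) ∈ weightFilt F w e := by
  induction u using induction_left with
  | one => simpa using hv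
  | add u v hu hv => simpa [add_mul] using add_mem hu hv
  | smul c u hu => simpa using Submodule.smul_mem _ c hu
  | ι_mul y u hu =>
    rw [mul_assoc]
    simpa using pbw_ι_mul_mem hw (a := 0) (x := y) (by simp [b.span_eq]) hu

/-- The right factor `v` is carried along so that the induction can peel off one factor of `envIdeal
N` on the left; an element of N adds at least one to the weight, and any other left factor does not
lower it. -/
theorem pbw_pow_mul_mem {b : Basis I F L} {w : I → ℕ} (hw : IsWeight b w) {N : LieIdeal F L}
    (hN : N.toSubmodule ≤ Submodule.span F (b '' {i | 1 ≤ w i})) {e : ℕ} (n : ℕ)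
    {u v : UniversalEnvelopingAlgebra F L} (hu : u ∈ envIdeal N ^ n)
    (hv : pbw b v ∈ weightFilt F w e) : pbw b (u * v) ∈ weightFilt F w (n + e) := by
  induction n generalizing u with
  | zero =>
    rw [zero_add]
    exact pbw_mul_mem hw u hv
  | succ n ih =>
    rw [pow_succ'] at hu
    refine Submodule.mul_induction_on hu (fun a ha c hc => ?_)
      fun u u' hu hu' => by simpa [add_mul] using add_mem hu hu'
    · have : envIdeal N ≤ (weightFilt F w (n + 1 + e)).comap
          ((pbw b).toLinearMap ∘ₗ LinearMap.mulRight F (c * v)) :=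
        envIdeal_le.2 fun x hx t => by
          have := pbw_ι_mul_mem hw (hN hx) (pbw_mul_mem hw t (ih hc))
          rw [show n + 1 + e = 1 + (n + e) by omega]
          simpa [mul_assoc] using this
      simpa [mul_assoc] using this ha

theorem pbw_pow_mem {b : Basis I F L} {w : I → ℕ} (hw : IsWeight b w) {N : LieIdeal F L}
    (hN : N.toSubmodule ≤ Submodule.span F (b '' {i | 1 ≤ w i})) {n : ℕ}
    {u : UniversalEnvelopingAlgebra F L} (hu : u ∈ envIdeal N ^ n) :
    pbw b u ∈ weightFilt F w n := by
  have h1 : pbw b 1 ∈ weightFilt F w 0 := by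
    intro Q _
    exact Nat.zero_le _
  simpa using pbw_pow_mul_mem hw hN n hu h1

end PBW

namespace UniversalEnvelopingAlgebra

open PBW

variable {F L : Type*} [Field F] [LieRing L] [LieAlgebra F L]

/-- Each monomial Q has finite weight, while `u` lies in the power of exponent one more than that
weight; so the coefficient of Q in `u` is zero. -/
theorem eq_zero_of_forall_mem_envIdeal_pow_of_nilpotent {N : LieIdeal F L} {c : ℕ}
    (hc : N.centralFiltration c = ⊥) {u : UniversalEnvelopingAlgebra F L}
    (hu : ∀ n, u ∈ envIdeal N ^ (n + 1)) : u = 0 := by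
  classical
  obtain ⟨T, b, w, hb⟩ := exists_basis_adapted (fun k => (N.centralFiltration k).toSubmodule)
    (fun _ _ h => N.centralFiltration_antitone h) rfl (c := c) (by simp [hc])
  let _ : LinearOrder T := linearOrderOfSTO WellOrderingRel
  have hw := isWeight_of_centralFiltration hb
  rw [← (pbw b).map_eq_zero_iff]
  ext Q
  by_contra hQ
  have := pbw_pow_mem hw (hb 1).le (hu (Q.map w).sum) (Finsupp.mem_support_iff.2 hQ)
  simp at this

/-- A basis vector occurring in `x` is a monomial of degree one, so it has weight at least c and
lies in the c-th term, which is zero. -/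
theorem eq_zero_of_ι_mem_envIdeal_pow {c : ℕ} (hc : (⊤ : LieIdeal F L).centralFiltration c = ⊥)
    {x : L} (hx : ι F x ∈ envIdeal (⊤ : LieIdeal F L) ^ c) : x = 0 := by
  classical
  obtain ⟨T, b, w, hb⟩ := exists_basis_adapted
    (fun k => ((⊤ : LieIdeal F L).centralFiltration k).toSubmodule)
    (fun _ _ h => LieIdeal.centralFiltration_antitone _ h) rfl (c := c) (by simp [hc])
  let _ : LinearOrder T := linearOrderOfSTO WellOrderingRel
  have hw := isWeight_of_centralFiltration hb
  refine b.repr.injective (Finsupp.ext fun i => ?_)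
  rw [← pbw_ι_apply, map_zero, Finsupp.zero_apply]
  by_contra hi
  have h1 := pbw_pow_mem hw (hb 1).le hx (Finsupp.mem_support_iff.2 hi)
  have h2 : b i ∈ Submodule.span F (b '' {i | c ≤ w i}) :=
    Submodule.subset_span ⟨i, by simpa using h1, rfl⟩
  rw [← hb c, hc] at h2
  exact b.ne_zero i (by simpa using h2)

end UniversalEnvelopingAlgebra

/-! ### Quotients by Lie ideals and comparison with the lower central series -/

namespace LieIdeal

variable {F L : Type*} [Field F] [LieRing L] [LieAlgebra F L]

/-- The quotient map by a Lie ideal, as a homomorphism of Lie algebras. -/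
def mkHom (K : LieIdeal F L) : L →ₗ⁅F⁆ L ⧸ K :=
  { (LieSubmodule.Quotient.mk' K : L →ₗ[F] L ⧸ K) with
    map_lie' := fun {x y} => LieSubmodule.Quotient.mk_bracket K x y }

theorem mkHom_surjective (K : LieIdeal F L) : Function.Surjective K.mkHom :=
  LieSubmodule.Quotient.surjective_mk' K

theorem mkHom_eq_zero {K : LieIdeal F L} {x : L} : K.mkHom x = 0 ↔ x ∈ K :=
  LieSubmodule.Quotient.mk_eq_zero K

/-- The homomorphism out of a quotient Lie algebra induced by one that vanishes on the ideal. -/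
def liftHom {L' : Type*} [LieRing L'] [LieAlgebra F L'] (K : LieIdeal F L) (f : L →ₗ⁅F⁆ L')
    (h : ∀ x ∈ K, f x = 0) : L ⧸ K →ₗ⁅F⁆ L' :=
  { K.toSubmodule.liftQ (f : L →ₗ[F] L') h with
    map_lie' := fun {x y} => by
      obtain ⟨x, rfl⟩ := K.mkHom_surjective x
      obtain ⟨y, rfl⟩ := K.mkHom_surjective y
      rw [← LieHom.map_lie]
      exact LieHom.map_lie f x y }

theorem map_top_of_surjective {L' : Type*} [LieRing L'] [LieAlgebra F L'] {f : L →ₗ⁅F⁆ L'}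
    (hf : Function.Surjective f) : (⊤ : LieIdeal F L).map f = ⊤ := by
  rw [← LieHom.idealRange_eq_map, f.idealRange_eq_top_of_surjective hf]

theorem map_centralFiltration {L' : Type*} [LieRing L'] [LieAlgebra F L'] {f : L →ₗ⁅F⁆ L'}
    (hf : Function.Surjective f) (N : LieIdeal F L) (k : ℕ) :
    (N.map f).centralFiltration k = (N.centralFiltration k).map f := by
  induction k using Nat.strong_induction_on with
  | _ k ih =>
  match k with
  | 0 => exact (map_top_of_surjective hf).symm
  | 1 => rfl
  | k + 2 =>
    rw [centralFiltration, centralFiltration, ih _ (by omega), LieIdeal.map_bracket_eq f hf]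

theorem map_mkHom_centralFiltration (N : LieIdeal F L) (k : ℕ) :
    (N.map (N.centralFiltration k).mkHom).centralFiltration k = ⊥ := by
  rw [map_centralFiltration (mkHom_surjective _), LieIdeal.map_eq_bot_iff]
  intro x hx
  exact LieHom.mem_ker.2 (mkHom_eq_zero.2 hx)

/-- The indices differ by one: the filtration has `N` in degree one, while the lower central series
of the Lie algebra `N` starts in degree zero. -/
theorem coe_mem_centralFiltration (N : LieIdeal F L) (k : ℕ) (x : N) :
    (x : L) ∈ N.centralFiltration (k + 1) ↔ x ∈ LieModule.lowerCentralSeries F N N k := by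
  have key : (N.centralFiltration (k + 1)).toSubmodule =
      (LieModule.lowerCentralSeries F N N k).toSubmodule.map N.toSubmodule.subtype := by
    induction k with
    | zero =>
      simp [centralFiltration]
    | succ k ih =>
      rw [centralFiltration, LieModule.lowerCentralSeries_succ,
        LieSubmodule.lieIdeal_oper_eq_linear_span', LieSubmodule.lieIdeal_oper_eq_linear_span',
        Submodule.map_span]
      congr 1
      ext z
      constructor
      · rintro ⟨a, ha, c, hc, rfl⟩
        rw [← LieSubmodule.mem_toSubmodule, ih] at hc
        obtain ⟨c, hc, rfl⟩ := hc
        exact ⟨⁅(⟨a, ha⟩ : N), c⁆, ⟨_, trivial, c, hc, rfl⟩, rfl⟩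
      · rintro ⟨_, ⟨a, -, c, hc, rfl⟩, rfl⟩
        refine ⟨a, a.2, c, ?_, rfl⟩
        rw [← LieSubmodule.mem_toSubmodule, ih]
        exact ⟨c, hc, rfl⟩
  rw [← LieSubmodule.mem_toSubmodule, key]
  constructor
  · rintro ⟨y, hy, h⟩
    rwa [← Subtype.ext (a1 := y) (a2 := x) h]
  · exact fun h => ⟨x, h, rfl⟩

theorem centralFiltration_top (k : ℕ) : (⊤ : LieIdeal F L).centralFiltration (k + 1) =
    LieModule.lowerCentralSeries F L L k := by
  induction k with
  | zero => rfl
  | succ k ih => rw [centralFiltration, ih, LieModule.lowerCentralSeries_succ]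

end LieIdeal

/-! ### Residual nilpotence through powers of ideals -/

namespace UniversalEnvelopingAlgebra

open PBW

attribute [local instance] LieRing.ofAssociativeRing

variable {F L : Type*} [Field F] [LieRing L] [LieAlgebra F L]

/-- The projection of U(L) modulo the two-sided ideal `envIdeal K` kills K, hence factors through
U(L/K) by the universal properties. -/
theorem mem_envIdeal_of_map_mkHom_eq_zero {K : LieIdeal F L} {u : UniversalEnvelopingAlgebra F L}
    (hu : map K.mkHom u = 0) : u ∈ envIdeal K := by
  obtain ⟨J, hJ⟩ : ∃ J : Ideal (UniversalEnvelopingAlgebra F L), ∀ u, u ∈ J ↔ u ∈ envIdeal K :=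
    ⟨{ (envIdeal K).toAddSubmonoid with
      smul_mem' := fun c _ hx => mul_mem_envIdeal_left c hx }, fun _ => Iff.rfl⟩
  have : J.IsTwoSided :=
    ⟨fun b ha => (hJ _).2 (mul_mem_envIdeal_right ((hJ _).1 ha) b)⟩
  let q : UniversalEnvelopingAlgebra F L →ₐ[F] UniversalEnvelopingAlgebra F L ⧸ J :=
    Ideal.Quotient.mkₐ F J
  have hq : ∀ u, q u = 0 ↔ u ∈ envIdeal K := fun u =>
    Ideal.Quotient.eq_zero_iff_mem.trans (hJ u)
  have hqι : ∀ x ∈ K, ((q : UniversalEnvelopingAlgebra F L →ₗ⁅F⁆ UniversalEnvelopingAlgebra F L ⧸ J).comp (ι F)) x = 0 :=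
    fun x hx => (hq _).2 (ι_mem_envIdeal hx)
  let g := K.liftHom ((q : UniversalEnvelopingAlgebra F L →ₗ⁅F⁆ UniversalEnvelopingAlgebra F L ⧸ J).comp (ι F)) hqι
  have h : (lift F g).comp (map K.mkHom) = q := by
    ext x
    simp only [LieHom.comp_apply, AlgHom.coe_toLieHom, AlgHom.comp_apply, map_ι]
    rw [lift_ι_apply]
    rfl
  have := DFunLike.congr_fun h u
  rw [AlgHom.comp_apply, hu, map_zero] at this
  exact (hq u).1 this.symm

theorem _root_.Module.Basis.exists_basis_of_surjective {E E' J : Type*} [AddCommGroup E]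
    [Module F E] [AddCommGroup E'] [Module F E'] (b : Module.Basis J F E) {f : E →ₗ[F] E'}
    (hf : Function.Surjective f) {T : Set J} (h : Disjoint (Submodule.span F (b '' T)) f.ker) :
    ∃ (T' : Set J) (b' : Module.Basis T' F E'), T ⊆ T' ∧ ∀ i : T', b' i = f (b i) := by
  have hT : LinearIndepOn F (fun i => f (b i)) T := by
    have h1 : LinearIndepOn F b T := b.linearIndependent.linearIndepOn _
    refine LinearIndependent.map (f := f) h1 ?_
    change Disjoint (Submodule.span F (Set.range fun i : T => b i)) _
    rwa [← Set.image_eq_range]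
  obtain ⟨T', -, hTT', hspan, hind⟩ := exists_linearIndepOn_extension hT (Set.subset_univ _)
  have htop : ⊤ ≤ Submodule.span F (Set.range fun i : T' => f (b i)) := by
    have h1 : Submodule.span F (Set.range b) ≤
        (Submodule.span F (Set.range fun i : T' => f (b i))).comap f := by
      rw [Submodule.span_le]
      rintro _ ⟨i, rfl⟩
      have := hspan ⟨i, trivial, rfl⟩
      rwa [Set.image_eq_range] at this
    intro y _
    obtain ⟨x, rfl⟩ := hf y
    exact h1 (by simp [b.span_eq])
  exact ⟨T', Module.Basis.mk hind htop, hTT', fun i => Module.Basis.mk_apply _ _ i⟩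

/-- Ordered monomials in the surviving basis vectors map to ordered monomials, so on their span the
induced map of enveloping algebras is injective. -/
theorem map_pbw_symm {L' I : Type*} [LieRing L'] [LieAlgebra F L'] [LinearOrder I]
    (b : Module.Basis I F L) {T : Set I} (b' : Module.Basis T F L') {f : L →ₗ⁅F⁆ L'}
    (h : ∀ i : T, b' i = f (b i)) (p : Multiset T →₀ F) :
    map f ((pbw b).symm (p.mapDomain (Multiset.map Subtype.val))) = (pbw b').symm p := by
  induction p using Finsupp.induction_linear with
  | zero => simp
  | add p q hp hq => simp [Finsupp.mapDomain_add, hp, hq]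
  | single Q c =>
    rw [Finsupp.mapDomain_single, ← mul_one c, ← smul_eq_mul, ← Finsupp.smul_single,
      ← Finsupp.smul_single, map_smul, map_smul, map_smul, pbw_symm_mono, pbw_symm_mono,
      sortedProd, sortedProd, map_list_prod,
      ← Multiset.map_sort (Subtype.val : T → _) Q (· ≤ ·) (· ≤ ·) (fun a _ b _ => Iff.rfl),
      List.map_map, List.map_map]
    congr 3
    ext i
    simp only [Function.comp_apply, map_ι, h]

/-- An element `u` involves only finitely many basis vectors. Their span V meets some K n trivially,
so they stay independent in L / K n and extend to a basis there consisting of images of basis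
vectors; `u` then has the same PBW expansion in the quotient. -/
theorem exists_map_mkHom_ne_zero {K : ℕ → LieIdeal F L} (hK : Antitone K)
    (h0 : ∀ x, (∀ n, x ∈ K n) → x = 0) {u : UniversalEnvelopingAlgebra F L} (hu : u ≠ 0) :
    ∃ n, map (K n).mkHom u ≠ 0 := by
  classical
  let b := Module.Basis.ofVectorSpace F L
  let _ : LinearOrder (Module.Basis.ofVectorSpaceIndex F L) := linearOrderOfSTO WellOrderingRel
  set p := pbw b u with hp
  let T : Finset (Module.Basis.ofVectorSpaceIndex F L) := p.support.biUnion Multiset.toFinset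
  let V : Submodule F L := Submodule.span F (b '' T)
  have : FiniteDimensional F V := FiniteDimensional.span_of_finite F (T.finite_toSet.image b)
  -- The descending chain V ∩ K n stabilizes in the finite-dimensional V, and its stable value lies
  -- in every K n, hence is zero.
  obtain ⟨n, hn⟩ := IsArtinian.monotone_stabilizes (R := F) (M := V)
    ⟨fun n => OrderDual.toDual ((K n).toSubmodule.comap V.subtype),
      fun m n h x hx => hK h hx⟩
  have hdisj : Disjoint V (K n).toSubmodule := by
    rw [Submodule.disjoint_def]
    refine fun x hx hxn => h0 x fun m => ?_
    rcases le_total m n with h | h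
    · exact hK h hxn
    · have h1 : (K n).toSubmodule.comap V.subtype = (K m).toSubmodule.comap V.subtype := hn m h
      have h2 : (⟨x, hx⟩ : V) ∈ (K n).toSubmodule.comap V.subtype := hxn
      rw [h1] at h2
      exact h2
  refine ⟨n, fun hmap => hu ?_⟩
  obtain ⟨T', b', hTT', hb'⟩ := b.exists_basis_of_surjective
    (f := ((K n).mkHom : L →ₗ[F] L ⧸ K n)) (K n).mkHom_surjective (T := T) (by
      convert hdisj
      ext x
      exact LieIdeal.mkHom_eq_zero)
  have hinj : Function.Injective (Multiset.map (Subtype.val : T' → _)) :=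
    Multiset.map_injective Subtype.val_injective
  obtain ⟨p', hp'⟩ : ∃ p' : Multiset T' →₀ F, p'.mapDomain (Multiset.map Subtype.val) = p := by
    refine ⟨p.comapDomain _ hinj.injOn, Finsupp.mapDomain_comapDomain _ hinj _ fun Q hQ => ?_⟩
    have hQ' : ∀ i ∈ Q, i ∈ T' := fun i hi => hTT' <| by
      simp only [T, Finset.coe_biUnion, Set.mem_iUnion]
      exact ⟨Q, hQ, by simpa using hi⟩
    lift Q to Multiset T' using hQ'
    exact ⟨Q, rfl⟩
  have h1 := map_pbw_symm b b' (f := (K n).mkHom) hb' p'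
  rw [hp', hp, LinearEquiv.symm_apply_apply, hmap] at h1
  have h2 : p' = 0 := by simpa using h1.symm
  rw [h2, Finsupp.mapDomain_zero] at hp'
  simpa [hp] using hp'.symm

theorem ι_mem_envIdeal_pow {N : LieIdeal F L} {n : ℕ} {x : L}
    (hx : x ∈ N.centralFiltration (n + 1)) : ι F x ∈ envIdeal N ^ (n + 1) := by
  induction n generalizing x with
  | zero =>
    rw [zero_add, pow_one]
    exact ι_mem_envIdeal hx
  | succ n ih =>
    have : (N.centralFiltration (n + 2)).toSubmodule ≤
        (envIdeal N ^ (n + 2)).comap (ι F : L →ₗ⁅F⁆ UniversalEnvelopingAlgebra F L).toLinearMap := by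
      rw [LieIdeal.centralFiltration, LieSubmodule.lieIdeal_oper_eq_linear_span',
        Submodule.span_le]
      rintro _ ⟨a, ha, c, hc, rfl⟩
      change ι F ⁅a, c⁆ ∈ envIdeal N ^ (n + 2)
      rw [LieHom.map_lie, LieRing.of_associative_ring_bracket]
      refine sub_mem ?_ ?_
      · rw [pow_succ']
        exact Submodule.mul_mem_mul (ι_mem_envIdeal ha) (ih hc)
      · rw [pow_succ]
        exact Submodule.mul_mem_mul (ih hc) (ι_mem_envIdeal ha)
    exact this hx

/-- A nonzero `u` survives in U of a quotient by some term of the filtration, where the image of N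
is nilpotent and the nilpotent case applies. The converse uses injectivity of `ι`. -/
theorem forall_mem_centralFiltration_iff (N : LieIdeal F L) :
    (∀ x, (∀ n, x ∈ N.centralFiltration (n + 1)) → x = 0) ↔
      ∀ u, (∀ n, u ∈ envIdeal N ^ (n + 1)) → u = 0 := by
  constructor
  · intro h u hu
    by_contra hu0
    obtain ⟨n, hn⟩ := exists_map_mkHom_ne_zero N.centralFiltration_antitone
      (fun x hx => h x fun n => hx (n + 1)) hu0
    exact hn <| eq_zero_of_forall_mem_envIdeal_pow_of_nilpotent
      (N.map_mkHom_centralFiltration n)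
      fun k => map_mem_envIdeal_pow _ (fun x hx => LieIdeal.mem_map hx) (hu k)
  · intro h x hx
    exact ι_injective ((h _ fun n => ι_mem_envIdeal_pow (hx n)).trans (map_zero _).symm)

theorem ι_mem_envIdeal_pow_iff {n : ℕ} {x : L} : ι F x ∈ envIdeal (⊤ : LieIdeal F L) ^ (n + 1) ↔
    x ∈ (⊤ : LieIdeal F L).centralFiltration (n + 1) := by
  refine ⟨fun hx => ?_, ι_mem_envIdeal_pow⟩
  rw [← LieIdeal.mkHom_eq_zero]
  refine eq_zero_of_ι_mem_envIdeal_pow (F := F) (c := n + 1) ?_ ?_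
  · have := (⊤ : LieIdeal F L).map_mkHom_centralFiltration (n + 1)
    rwa [LieIdeal.map_top_of_surjective (LieIdeal.mkHom_surjective _)] at this
  · rw [← map_ι]
    exact map_mem_envIdeal_pow _ (fun _ _ => LieSubmodule.mem_top _) hx

theorem lieIsResiduallyNilpotent_iff : LieIsResiduallyNilpotent F L ↔
    ∀ u, (∀ n, u ∈ envIdeal (⊤ : LieIdeal F L) ^ (n + 1)) → u = 0 := by
  rw [← forall_mem_centralFiltration_iff, LieIsResiduallyNilpotent, eq_bot_iff]
  simp only [LieIdeal.centralFiltration_top]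
  refine forall_congr' fun x => ?_
  simp [LieSubmodule.mem_iInf]

theorem lieIsResiduallyNilpotent_ideal_iff (N : LieIdeal F L) : LieIsResiduallyNilpotent F N ↔
    ∀ u, (∀ n, u ∈ envIdeal N ^ (n + 1)) → u = 0 := by
  rw [← forall_mem_centralFiltration_iff, LieIsResiduallyNilpotent, eq_bot_iff]
  constructor
  · intro h x hx
    have hxN : x ∈ N := hx 0
    have := @h ⟨x, hxN⟩ (by
      rw [LieSubmodule.mem_iInf]
      exact fun n => (N.coe_mem_centralFiltration n ⟨x, hxN⟩).1 (hx n))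
    simpa using this
  · intro h x hx
    rw [LieSubmodule.mem_iInf] at hx
    rw [LieSubmodule.mem_bot]
    exact Subtype.ext (h x fun n => (N.coe_mem_centralFiltration n x).2 (hx n))

end UniversalEnvelopingAlgebra

/-! ### Augmentations, the commutator ideal and their invariance -/

namespace UniversalEnvelopingAlgebra

open PBW

attribute [local instance] LieRing.ofAssociativeRing

variable {F L : Type*} [Field F] [LieRing L] [LieAlgebra F L]

/-- The augmentation of the enveloping algebra. -/
noncomputable def augmentation (F L : Type*) [Field F] [LieRing L] [LieAlgebra F L] :
    UniversalEnvelopingAlgebra F L →ₐ[F] F :=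
  lift F (0 : L →ₗ⁅F⁆ F)

theorem augmentation_ι (x : L) : augmentation F L (ι F x) = 0 :=
  lift_ι_apply F _ x

theorem sub_algebraMap_augmentation_mem (u : UniversalEnvelopingAlgebra F L) :
    u - algebraMap F _ (augmentation F L u) ∈ envIdeal (⊤ : LieIdeal F L) := by
  induction u using induction_left with
  | one => simp
  | ι_mul x u hu =>
    rw [map_mul, augmentation_ι, zero_mul, map_zero, sub_zero]
    exact ι_mul_mem_envIdeal (LieSubmodule.mem_top _) _
  | add u v hu hv =>
    rw [map_add, map_add, add_sub_add_comm]
    exact add_mem hu hv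
  | smul c u hu =>
    rw [map_smul, smul_eq_mul, map_mul, ← Algebra.smul_def, ← smul_sub]
    exact Submodule.smul_mem _ _ hu

theorem mem_envIdeal_top {u : UniversalEnvelopingAlgebra F L} :
    u ∈ envIdeal (⊤ : LieIdeal F L) ↔ augmentation F L u = 0 := by
  constructor
  · intro hu
    have : envIdeal (⊤ : LieIdeal F L) ≤ (augmentation F L).toLinearMap.ker :=
      envIdeal_le.2 fun x _ u => by
        rw [LinearMap.mem_ker, AlgHom.toLinearMap_apply, map_mul, augmentation_ι, zero_mul]
    exact this hu
  · intro hu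
    simpa [hu] using sub_algebraMap_augmentation_mem u

theorem character_lie (χ : L →ₗ⁅F⁆ F) (x y : L) : χ ⁅x, y⁆ = 0 := by
  rw [LieHom.map_lie, LieRing.of_associative_ring_bracket, mul_comm, sub_self]

/-- The algebra endomorphism `x ↦ x - χ x` of the enveloping algebra. -/
noncomputable def shift (χ : L →ₗ⁅F⁆ F) :
    UniversalEnvelopingAlgebra F L →ₐ[F] UniversalEnvelopingAlgebra F L :=
  lift F
    { (ι F : L →ₗ⁅F⁆ UniversalEnvelopingAlgebra F L).toLinearMap -
        (Algebra.linearMap F _) ∘ₗ (χ : L →ₗ[F] F) with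
      map_lie' := fun {x y} => by
        have h := character_lie χ x y
        change ι F ⁅x, y⁆ - algebraMap F _ (χ ⁅x, y⁆) = ⁅ι F x - algebraMap F _ (χ x),
          ι F y - algebraMap F _ (χ y)⁆
        rw [h, map_zero, sub_zero, LieHom.map_lie, LieRing.of_associative_ring_bracket,
          LieRing.of_associative_ring_bracket, sub_mul, mul_sub, mul_sub, sub_mul, mul_sub, mul_sub,
          Algebra.commutes (χ x), Algebra.commutes (χ y) (ι F x),
          Algebra.commutes (χ y) (algebraMap F _ (χ x))]
        abel }

theorem shift_ι (χ : L →ₗ⁅F⁆ F) (x : L) :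
    shift χ (ι F x) = ι F x - algebraMap F _ (χ x) :=
  lift_ι_apply F _ x

theorem shift_comp_shift {χ χ' : L →ₗ⁅F⁆ F} (h : ∀ x, χ' x + χ x = 0) :
    (shift χ').comp (shift χ) = AlgHom.id F _ := by
  ext x
  simp only [LieHom.comp_apply, AlgHom.coe_toLieHom, AlgHom.comp_apply, shift_ι, map_sub,
    AlgHom.commutes, AlgHom.id_apply]
  rw [sub_sub, ← map_add, h, map_zero, sub_zero]

variable {H : Type*} [LieRing H] [LieAlgebra F H]

/-- The augmentation of U(H) pulled back along `e` restricts to a character χ of `L`. Precomposing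
`e` with the automorphism x ↦ x - χ(x) makes the pullback vanish on `L`. -/
theorem exists_augmentation_preserving
    (e : UniversalEnvelopingAlgebra F L ≃ₐ[F] UniversalEnvelopingAlgebra F H) :
    ∃ e' : UniversalEnvelopingAlgebra F L ≃ₐ[F] UniversalEnvelopingAlgebra F H,
      ∀ u, augmentation F H (e' u) = augmentation F L u := by
  let χ : L →ₗ⁅F⁆ F :=
    (((augmentation F H).comp e.toAlgHom : UniversalEnvelopingAlgebra F L →ₐ[F] F) :
      UniversalEnvelopingAlgebra F L →ₗ⁅F⁆ F).comp (ι F)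
  let χ' : L →ₗ⁅F⁆ F :=
    { -(χ : L →ₗ[F] F) with
      map_lie' := fun {x y} => by
        have h1 : -χ ⁅x, y⁆ = ⁅-χ x, -χ y⁆ := by
          rw [character_lie, LieRing.of_associative_ring_bracket, mul_comm, sub_self, neg_zero]
        exact h1 }
  have hχ : ∀ x, χ' x = -χ x := fun _ => rfl
  let τ := AlgEquiv.ofAlgHom (shift χ) (shift χ') (shift_comp_shift fun x => by simp [hχ])
    (shift_comp_shift fun x => by simp [hχ])
  refine ⟨τ.trans e, ?_⟩
  have : (augmentation F H).comp (τ.trans e).toAlgHom = augmentation F L := by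
    ext x
    have h1 : shift χ (ι F x) = ι F x - algebraMap F _ (augmentation F H (e (ι F x))) :=
      shift_ι χ x
    change augmentation F H (e (shift χ (ι F x))) = augmentation F L (ι F x)
    rw [h1, augmentation_ι, map_sub, map_sub, AlgEquiv.commutes, AlgHom.commutes]
    exact sub_self _
  exact fun u => DFunLike.congr_fun this u

theorem envIdeal_mul_top (N : LieIdeal F L) : envIdeal N * ⊤ = envIdeal N := by
  refine le_antisymm (Submodule.mul_le.2 fun a ha u _ => mul_mem_envIdeal_right ha u) ?_
  intro a ha
  simpa using Submodule.mul_mem_mul ha (Submodule.mem_top : (1 : UniversalEnvelopingAlgebra F L) ∈ ⊤)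

theorem envIdeal_mul_le (N : LieIdeal F L) (S : Submodule F (UniversalEnvelopingAlgebra F L)) :
    envIdeal N * S ≤ envIdeal N :=
  Submodule.mul_le.2 fun _ ha u _ => mul_mem_envIdeal_right ha u

/-- Split the right factor of ι(x)u into its augmentation, a scalar, and an element of the
augmentation ideal. -/
theorem envIdeal_le_sup (N : LieIdeal F L) : envIdeal N ≤
    N.toSubmodule.map (ι F : L →ₗ⁅F⁆ UniversalEnvelopingAlgebra F L).toLinearMap ⊔
      envIdeal N * envIdeal (⊤ : LieIdeal F L) := by
  refine envIdeal_le.2 fun x hx u => ?_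
  have h1 : ι F x * u = augmentation F L u • ι F x +
      ι F x * (u - algebraMap F _ (augmentation F L u)) := by
    rw [mul_sub, ← Algebra.commutes, ← Algebra.smul_def]
    abel
  rw [h1]
  exact Submodule.add_mem_sup (Submodule.smul_mem _ _ ⟨x, hx, rfl⟩)
    (Submodule.mul_mem_mul (ι_mem_envIdeal hx) (sub_algebraMap_augmentation_mem u))

theorem top_mul_envIdeal (N : LieIdeal F L) : ⊤ * envIdeal N = envIdeal N := by
  refine le_antisymm (Submodule.mul_le.2 fun u _ a ha => mul_mem_envIdeal_left u ha) ?_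
  intro a ha
  simpa using Submodule.mul_mem_mul (Submodule.mem_top : (1 : UniversalEnvelopingAlgebra F L) ∈ ⊤) ha

theorem lie_mem_envIdeal {N : LieIdeal F L} (h : ∀ x y : L, ⁅x, y⁆ ∈ N)
    (u v : UniversalEnvelopingAlgebra F L) : u * v - v * u ∈ envIdeal N := by
  have key : ∀ (y : L) (u : UniversalEnvelopingAlgebra F L),
      u * ι F y - ι F y * u ∈ envIdeal N := by
    intro y u
    induction u using induction_left with
    | one => simp
    | add u v hu hv =>
      rw [add_mul, mul_add, add_sub_add_comm]
      exact add_mem hu hv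
    | smul c u hu =>
      rw [smul_mul_assoc, mul_smul_comm, ← smul_sub]
      exact Submodule.smul_mem _ _ hu
    | ι_mul x u hu =>
      have : ι F x * u * ι F y - ι F y * (ι F x * u) =
          ι F x * (u * ι F y - ι F y * u) + ι F ⁅x, y⁆ * u := by
        rw [LieHom.map_lie, LieRing.of_associative_ring_bracket]
        noncomm_ring
      rw [this]
      exact add_mem (mul_mem_envIdeal_left _ hu) (ι_mul_mem_envIdeal (h x y) _)
  induction v using induction_left with
  | one => simp
  | add v v' hv hv' =>
    rw [mul_add, add_mul, add_sub_add_comm]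
    exact add_mem hv hv'
  | smul c v hv =>
    rw [mul_smul_comm, smul_mul_assoc, ← smul_sub]
    exact Submodule.smul_mem _ _ hv
  | ι_mul x v hv =>
    have : u * (ι F x * v) - ι F x * v * u =
        (u * ι F x - ι F x * u) * v + ι F x * (u * v - v * u) := by
      noncomm_ring
    rw [this]
    exact add_mem (mul_mem_envIdeal_right (key x u) _) (mul_mem_envIdeal_left _ hv)

/-- The right side mentions only the associative algebra, so this ideal is preserved by every
algebra isomorphism, whether or not it respects augmentations. -/
theorem envIdeal_derived : envIdeal (lieDerived F L) =
    ⊤ * Submodule.span F {c | ∃ u v : UniversalEnvelopingAlgebra F L, u * v - v * u = c} * ⊤ := by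
  have hder : lieDerived F L = ⁅(⊤ : LieIdeal F L), (⊤ : LieIdeal F L)⁆ := rfl
  apply le_antisymm
  · refine envIdeal_le.2 fun x hx t => Submodule.mul_mem_mul ?_ Submodule.mem_top
    rw [← LieSubmodule.mem_toSubmodule, hder,
      LieSubmodule.lieIdeal_oper_eq_linear_span'] at hx
    rw [← one_mul (ι F x)]
    refine Submodule.mul_mem_mul Submodule.mem_top ?_
    induction hx using Submodule.span_induction with
    | zero => simp
    | add x y _ _ hx hy => rw [map_add]; exact add_mem hx hy
    | smul c x _ hx => rw [map_smul]; exact Submodule.smul_mem _ c hx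
    | mem x hx =>
      obtain ⟨a, -, c, -, rfl⟩ := hx
      exact Submodule.subset_span ⟨ι F a, ι F c, by
        rw [LieHom.map_lie, LieRing.of_associative_ring_bracket]⟩
  · have h1 : Submodule.span F {c | ∃ u v : UniversalEnvelopingAlgebra F L, u * v - v * u = c} ≤
        envIdeal (lieDerived F L) := by
      rw [Submodule.span_le]
      rintro _ ⟨u, v, rfl⟩
      exact lie_mem_envIdeal (fun x y => hder ▸ LieSubmodule.lie_mem_lie
        (LieSubmodule.mem_top x) (LieSubmodule.mem_top y)) u v
    calc _ ≤ ⊤ * envIdeal (lieDerived F L) * ⊤ := by gcongr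
      _ = _ := by rw [top_mul_envIdeal, envIdeal_mul_top]

theorem map_envIdeal_derived
    (e : UniversalEnvelopingAlgebra F L ≃ₐ[F] UniversalEnvelopingAlgebra F H) :
    (envIdeal (lieDerived F L)).map e.toAlgHom.toLinearMap = envIdeal (lieDerived F H) := by
  have htop : (⊤ : Submodule F (UniversalEnvelopingAlgebra F L)).map e.toAlgHom.toLinearMap = ⊤ := by
    rw [Submodule.map_top]
    exact LinearMap.range_eq_top.2 e.surjective
  rw [envIdeal_derived, envIdeal_derived, Submodule.map_mul, Submodule.map_mul, htop,
    Submodule.map_span]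
  congr 3
  ext c
  constructor
  · rintro ⟨_, ⟨u, v, rfl⟩, rfl⟩
    exact ⟨e u, e v, by simp⟩
  · rintro ⟨u, v, rfl⟩
    exact ⟨_, ⟨e.symm u, e.symm v, rfl⟩, by simp⟩

theorem map_envIdeal_top
    {e : UniversalEnvelopingAlgebra F L ≃ₐ[F] UniversalEnvelopingAlgebra F H}
    (he : ∀ u, augmentation F H (e u) = augmentation F L u) :
    (envIdeal (⊤ : LieIdeal F L)).map e.toAlgHom.toLinearMap = envIdeal (⊤ : LieIdeal F H) := by
  ext u
  constructor
  · rintro ⟨v, hv, rfl⟩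
    rw [SetLike.mem_coe, mem_envIdeal_top, ← he] at hv
    exact mem_envIdeal_top.2 hv
  · intro hu
    refine ⟨e.symm u, ?_, e.apply_symm_apply u⟩
    rw [mem_envIdeal_top] at hu
    rw [SetLike.mem_coe, mem_envIdeal_top, ← he, e.apply_symm_apply, hu]

theorem forall_mem_pow_iff_of_map_eq
    (e : UniversalEnvelopingAlgebra F L ≃ₐ[F] UniversalEnvelopingAlgebra F H)
    {N : LieIdeal F L} {K : LieIdeal F H}
    (h : (envIdeal N).map e.toAlgHom.toLinearMap = envIdeal K) :
    (∀ u, (∀ n, u ∈ envIdeal N ^ (n + 1)) → u = 0) ↔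
      ∀ u, (∀ n, u ∈ envIdeal K ^ (n + 1)) → u = 0 := by
  have key : ∀ n u, e u ∈ envIdeal K ^ n ↔ u ∈ envIdeal N ^ n := by
    intro n u
    rw [← h, ← Submodule.map_pow]
    exact ⟨fun ⟨v, hv, hvu⟩ => e.injective hvu ▸ hv, fun hu => ⟨u, hu, rfl⟩⟩
  rw [e.surjective.forall]
  simp [key]

end UniversalEnvelopingAlgebra

/-! ### The quotient of a Lie ideal by its derived ideal -/

theorem exists_linearOrder_initial {T : Type*} (S : Set T) :
    ∃ _ : LinearOrder T, ∀ i ∈ S, ∀ k, k ≤ i → k ∈ S := by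
  classical
  let o : LinearOrder T := linearOrderOfSTO WellOrderingRel
  refine ⟨LinearOrder.lift' (fun i => toLex ((if i ∈ S then 0 else 1 : ℕ), i)) ?_, ?_⟩
  · intro i j h
    exact congrArg (fun p => (ofLex p).2) h
  · intro i hi k hk
    have h1 : toLex ((if k ∈ S then 0 else 1 : ℕ), k) ≤ toLex ((if i ∈ S then 0 else 1 : ℕ), i) := hk
    by_contra hkS
    rw [Prod.Lex.toLex_le_toLex] at h1
    simp [hi, hkS] at h1

namespace PBW

open Finsupp Module UniversalEnvelopingAlgebra

variable {F L I : Type*} [Field F] [LieRing L] [LieAlgebra F L] [LinearOrder I]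

theorem augmentation_eq (b : Basis I F L) (u : UniversalEnvelopingAlgebra F L) :
    augmentation F L u = pbw b u 0 := by
  obtain ⟨p, rfl⟩ := (pbw b).symm.surjective u
  rw [LinearEquiv.apply_symm_apply]
  induction p using Finsupp.induction_linear with
  | zero => simp
  | add p q hp hq => simp [hp, hq]
  | single M c =>
    rw [← mul_one c, ← smul_eq_mul, ← smul_single, map_smul, map_smul, pbw_symm_mono]
    rcases eq_zero_or_eq_min_cons M with rfl | ⟨k, N, rfl, hk⟩
    · simp [sortedProd]
    · rw [sortedProd_cons b hk, map_mul, augmentation_ι]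
      simp

/-- If commuting basis vectors form an initial segment of the order, reordering x_i into a monomial
only passes vectors of the segment, so no correction terms arise. -/
theorem action_of_abelian (b : Basis I F L) {S : Set I} (hS : ∀ i ∈ S, ∀ k, k ≤ i → k ∈ S)
    (hab : ∀ i ∈ S, ∀ k ∈ S, ⁅b i, b k⁆ = 0) {i : I} (hi : i ∈ S) (M : Multiset I) :
    action b (b i) (mono F M) = mono F (i ::ₘ M) := by
  induction hn : M.card generalizing M with
  | zero =>
    obtain rfl : M = 0 := by simpa using hn
    exact action_of_le b (by simp)
  | succ n ih =>
    by_cases h : ∀ l ∈ M, i ≤ l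
    · exact action_of_le b h
    obtain ⟨k, N, rfl, hk, hki⟩ := exists_min_cons h
    rw [← action_of_le b hk, action_action_of_le b hk hki.le, hab i hi k (hS i hi k hki.le),
      ih N (by simpa using hn), action_of_le b (by simpa [hki.le] using hk), Multiset.cons_swap]
    simp

end PBW

namespace UniversalEnvelopingAlgebra

open PBW

attribute [local instance] LieRing.ofAssociativeRing

variable {F L : Type*} [Field F] [LieRing L] [LieAlgebra F L]

/-- Put a basis of N first in the order. Elements of N then act as multiplication by variables, so N
· U · ω has only monomials of degree at least two, whereas ι(x) has degree one. -/
theorem eq_zero_of_abelian {N : LieIdeal F L} (hN : ⁅N, N⁆ = ⊥) {x : L}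
    (hx : ι F x ∈ envIdeal N * envIdeal (⊤ : LieIdeal F L)) : x = 0 := by
  -- This two-step filtration serves only to produce a basis of `L` extending one of `N`.
  let V : ℕ → Submodule F L := fun k => if k = 0 then ⊤ else if k = 1 then N.toSubmodule else ⊥
  obtain ⟨T, b, w, hb⟩ := exists_basis_adapted V (c := 2)
    (antitone_nat_of_succ_le fun n => by
      rcases n with _ | _ | n <;> simp [V]) (by simp [V]) (by simp [V])
  obtain ⟨_, hS⟩ := exists_linearOrder_initial {i : T | 1 ≤ w i}
  have hbN : N.toSubmodule = Submodule.span F (b '' {i | 1 ≤ w i}) := by simpa [V] using hb 1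
  have hmem : ∀ i ∈ {i : T | 1 ≤ w i}, b i ∈ N := fun i hi => by
    rw [← LieSubmodule.mem_toSubmodule, hbN]
    exact Submodule.subset_span ⟨i, hi, rfl⟩
  have hab : ∀ i ∈ {i : T | 1 ≤ w i}, ∀ k ∈ {i : T | 1 ≤ w i}, ⁅b i, b k⁆ = 0 := by
    intro i hi k hk
    have := LieSubmodule.lie_mem_lie (hmem i hi) (hmem k hk)
    rwa [hN, LieSubmodule.mem_bot] at this
  have key : ∀ p : Multiset T →₀ F, p 0 = 0 → ∀ x ∈ N,
      action b x p ∈ Finsupp.supported F F {Q : Multiset T | 2 ≤ Q.card} := by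
    intro p hp x hx
    rw [← LieSubmodule.mem_toSubmodule, hbN] at hx
    induction hx using Submodule.span_induction with
    | zero => simp
    | add x y _ _ hx hy => simpa using add_mem hx hy
    | smul c x _ hx => simpa using Submodule.smul_mem _ c hx
    | mem x hx =>
      obtain ⟨i, hi, rfl⟩ := hx
      have hp' : p ∈ Finsupp.supported F F {Q : Multiset T | Q ≠ 0} := by
        intro Q hQ hQ0
        rw [Finset.mem_coe, Finsupp.mem_support_iff] at hQ
        exact hQ (hQ0 ▸ hp)
      have hle : Finsupp.supported F F {Q : Multiset T | Q ≠ 0} ≤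
          (Finsupp.supported F F {Q : Multiset T | 2 ≤ Q.card}).comap (action b (b i)) := by
        rw [Finsupp.supported_eq_span_single, Submodule.span_le]
        rintro _ ⟨Q, hQ, rfl⟩
        have : action b (b i) (mono F Q) ∈
            Finsupp.supported F F {Q : Multiset T | 2 ≤ Q.card} := by
          rw [action_of_abelian b hS hab hi]
          refine Finsupp.single_mem_supported F 1 ?_
          have := Multiset.card_pos.2 hQ
          simp
          omega
        exact this
      exact hle hp'
  have hle : envIdeal N * envIdeal (⊤ : LieIdeal F L) ≤
      (Finsupp.supported F F {Q : Multiset T | 2 ≤ Q.card}).comap (pbw b).toLinearMap := by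
    rw [Submodule.mul_le]
    intro a ha s hs
    have : envIdeal N ≤ ((Finsupp.supported F F {Q : Multiset T | 2 ≤ Q.card}).comap
        (pbw b).toLinearMap).comap (LinearMap.mulRight F s) := by
      refine envIdeal_le.2 fun x hx t => ?_
      rw [Submodule.mem_comap, Submodule.mem_comap, LinearMap.mulRight_apply, mul_assoc,
        LinearEquiv.coe_coe, pbw_ι_mul]
      refine key _ ?_ x hx
      rw [← augmentation_eq, ← mem_envIdeal_top]
      exact mul_mem_envIdeal_left _ hs
    exact this ha
  have hx' := hle hx
  refine b.repr.injective (Finsupp.ext fun i => ?_)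
  rw [← pbw_ι_apply, map_zero, Finsupp.zero_apply]
  by_contra hi
  simpa using hx' (Finsupp.mem_support_iff.2 hi)

/-- Passing to L/[N,N] reduces the forward direction to abelian N; the converse expands [a, c] as ac
- ca. -/
theorem ι_mem_envIdeal_mul_iff {N : LieIdeal F L} {x : L} :
    ι F x ∈ envIdeal N * envIdeal (⊤ : LieIdeal F L) ↔ x ∈ ⁅N, N⁆ := by
  constructor
  · intro hx
    let f := (⁅N, N⁆ : LieIdeal F L).mkHom
    have hN : ⁅N.map f, N.map f⁆ = ⊥ := by
      rw [← LieIdeal.map_bracket_eq f (LieIdeal.mkHom_surjective _), LieIdeal.map_eq_bot_iff]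
      intro x hx
      exact LieHom.mem_ker.2 (LieIdeal.mkHom_eq_zero.2 hx)
    rw [← LieIdeal.mkHom_eq_zero]
    refine eq_zero_of_abelian hN ?_
    rw [← map_ι]
    have h1 : map f (ι F x) ∈ (envIdeal N * envIdeal (⊤ : LieIdeal F L)).map (map f).toLinearMap :=
      ⟨_, hx, rfl⟩
    rw [Submodule.map_mul] at h1
    exact mul_le_mul' (map_envIdeal_le f fun x hx => LieIdeal.mem_map hx)
      (map_envIdeal_le f fun x _ => LieSubmodule.mem_top _) h1
  · intro hx
    have : (⁅N, N⁆ : LieIdeal F L).toSubmodule ≤ (envIdeal N * envIdeal (⊤ : LieIdeal F L)).comap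
        (ι F : L →ₗ⁅F⁆ UniversalEnvelopingAlgebra F L).toLinearMap := by
      rw [LieSubmodule.lieIdeal_oper_eq_linear_span', Submodule.span_le]
      rintro _ ⟨a, ha, c, hc, rfl⟩
      change ι F ⁅a, c⁆ ∈ envIdeal N * envIdeal (⊤ : LieIdeal F L)
      rw [LieHom.map_lie, LieRing.of_associative_ring_bracket]
      exact sub_mem
        (Submodule.mul_mem_mul (ι_mem_envIdeal ha) (ι_mem_envIdeal (LieSubmodule.mem_top _)))
        (Submodule.mul_mem_mul (ι_mem_envIdeal hc) (ι_mem_envIdeal (LieSubmodule.mem_top _)))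
    exact this hx

/-- The coinvariants of the ideal of the enveloping algebra generated by `N`. -/
abbrev EnvIdealQuotient (N : LieIdeal F L) : Type _ :=
  envIdeal N ⧸ (envIdeal N * envIdeal (⊤ : LieIdeal F L)).submoduleOf (envIdeal N)

/-- The map from a Lie ideal `N` to the coinvariants of the ideal generated by `N`. -/
noncomputable def toEnvIdealQuotient (N : LieIdeal F L) : N →ₗ[F] EnvIdealQuotient N :=
  Submodule.mkQ _ ∘ₗ LinearMap.codRestrict (envIdeal N)
    ((ι F : L →ₗ⁅F⁆ UniversalEnvelopingAlgebra F L).toLinearMap ∘ₗ N.toSubmodule.subtype)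
    fun x => ι_mem_envIdeal x.2

/-- By `envIdeal_le_sup`, every class modulo `envIdeal N` · ω has a representative in ι(N). -/
theorem toEnvIdealQuotient_surjective (N : LieIdeal F L) :
    Function.Surjective (toEnvIdealQuotient N) := by
  rw [← LinearMap.range_eq_top, eq_top_iff]
  rintro y -
  obtain ⟨⟨a, ha⟩, rfl⟩ := Submodule.mkQ_surjective _ y
  obtain ⟨_, ⟨x, hx, rfl⟩, c, hc, hac⟩ := Submodule.mem_sup.1 (envIdeal_le_sup N ha)
  refine ⟨⟨x, hx⟩, ?_⟩
  symm
  refine (Submodule.Quotient.eq _).2 ?_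
  change a - ι F x ∈ envIdeal N * envIdeal (⊤ : LieIdeal F L)
  have : a - ι F x = c := by
    rw [← hac]
    exact add_sub_cancel_left _ _
  rwa [this]

theorem toEnvIdealQuotient_eq_zero {N : LieIdeal F L} {x : N} :
    toEnvIdealQuotient N x = 0 ↔ (x : L) ∈ ⁅N, N⁆ :=
  (Submodule.Quotient.mk_eq_zero _).trans ι_mem_envIdeal_mul_iff

theorem mem_lieDerived_ideal {N : LieIdeal F L} {x : N} :
    x ∈ lieDerived F N ↔ (x : L) ∈ ⁅N, N⁆ := by
  have := N.coe_mem_centralFiltration 1 x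
  exact this.symm

variable {H : Type*} [LieRing H] [LieAlgebra F H]

theorem nonempty_envIdealQuotient_equiv
    (e : UniversalEnvelopingAlgebra F L ≃ₐ[F] UniversalEnvelopingAlgebra F H)
    {N : LieIdeal F L} {K : LieIdeal F H}
    (h : (envIdeal N).map e.toAlgHom.toLinearMap = envIdeal K)
    (htop : (envIdeal (⊤ : LieIdeal F L)).map e.toAlgHom.toLinearMap =
      envIdeal (⊤ : LieIdeal F H)) :
    Nonempty (EnvIdealQuotient N ≃ₗ[F] EnvIdealQuotient K) := by
  refine ⟨Submodule.Quotient.equiv _ _ (e.toLinearEquiv.ofSubmodules _ _ h) ?_⟩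
  have hmul : (envIdeal N * envIdeal (⊤ : LieIdeal F L)).map e.toAlgHom.toLinearMap =
      envIdeal K * envIdeal (⊤ : LieIdeal F H) := by
    rw [Submodule.map_mul, h, htop]
  ext ⟨y, hy⟩
  constructor
  · rintro ⟨x, hx, hxy⟩
    change y ∈ envIdeal K * envIdeal (⊤ : LieIdeal F H)
    rw [← hmul]
    exact ⟨x, hx, congrArg Subtype.val hxy⟩
  · intro hy'
    change y ∈ envIdeal K * envIdeal (⊤ : LieIdeal F H) at hy'
    rw [← hmul] at hy'
    obtain ⟨x, hx, rfl⟩ := hy'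
    have hxN : x ∈ envIdeal N := envIdeal_mul_le _ _ hx
    exact ⟨⟨x, hxN⟩, hx, rfl⟩

theorem nonempty_quotient_equiv_envIdealQuotient (N : LieIdeal F L) :
    Nonempty ((N ⧸ lieDerived F N) ≃ₗ[F] EnvIdealQuotient N) := by
  have hker : (lieDerived F N).toSubmodule = (toEnvIdealQuotient N).ker := by
    ext x
    exact mem_lieDerived_ideal.trans toEnvIdealQuotient_eq_zero.symm
  exact ⟨(Submodule.quotEquivOfEq _ _ hker).trans
    ((toEnvIdealQuotient N).quotKerEquivOfSurjective (toEnvIdealQuotient_surjective N))⟩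

theorem lie_eq_zero_of_quotient_derived (x y : L ⧸ lieDerived F L) : ⁅x, y⁆ = 0 := by
  obtain ⟨x, rfl⟩ := (lieDerived F L).mkHom_surjective x
  obtain ⟨y, rfl⟩ := (lieDerived F L).mkHom_surjective y
  rw [← LieHom.map_lie, LieIdeal.mkHom_eq_zero]
  exact LieSubmodule.lie_mem_lie (I := (⊤ : LieIdeal F L)) (N := (⊤ : LieIdeal F L))
    (LieSubmodule.mem_top x) (LieSubmodule.mem_top y)

/-- Both Lie algebras are abelian, so any linear isomorphism between them is one of Lie algebras. -/
theorem nonempty_derivedQuotient_equiv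
    {e : UniversalEnvelopingAlgebra F L ≃ₐ[F] UniversalEnvelopingAlgebra F H}
    (he : ∀ u, augmentation F H (e u) = augmentation F L u) :
    Nonempty (LieDerivedQuotient F L ≃ₗ⁅F⁆ LieDerivedQuotient F H) := by
  obtain ⟨f⟩ := nonempty_envIdealQuotient_equiv e (map_envIdeal_derived e) (map_envIdeal_top he)
  obtain ⟨g⟩ := nonempty_quotient_equiv_envIdealQuotient (lieDerived F L)
  obtain ⟨k⟩ := nonempty_quotient_equiv_envIdealQuotient (lieDerived F H)
  exact ⟨{ (g.trans f).trans k.symm with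
    map_lie' := fun {x y} => by
      rw [lie_eq_zero_of_quotient_derived, lie_eq_zero_of_quotient_derived]
      exact map_zero ((g.trans f).trans k.symm) }⟩

end UniversalEnvelopingAlgebra

/-! ### Iterated commutators and the nilpotence class -/

namespace UniversalEnvelopingAlgebra

attribute [local instance] LieRing.ofAssociativeRing

variable {F L H : Type*} [Field F] [LieRing L] [LieAlgebra F L] [LieRing H] [LieAlgebra F H]

/-- The iterated commutators of elements of a subspace of an associative algebra. -/
def commSeries {A : Type*} [Ring A] [Algebra F A] (W : Submodule F A) : ℕ → Submodule F A
  | 0 => W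
  | n + 1 => Submodule.span F {c | ∃ u ∈ W, ∃ v ∈ commSeries W n, u * v - v * u = c}

theorem map_commSeries {A B : Type*} [Ring A] [Algebra F A] [Ring B] [Algebra F B] (f : A →ₐ[F] B)
    (W : Submodule F A) (n : ℕ) :
    (commSeries W n).map f.toLinearMap = commSeries (W.map f.toLinearMap) n := by
  induction n with
  | zero => rfl
  | succ n ih =>
    rw [commSeries, commSeries, Submodule.map_span, ← ih]
    congr 1
    ext c
    constructor
    · rintro ⟨_, ⟨u, hu, v, hv, rfl⟩, rfl⟩
      exact ⟨f u, ⟨u, hu, rfl⟩, f v, ⟨v, hv, rfl⟩, by simp⟩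
    · rintro ⟨_, ⟨u, hu, rfl⟩, _, ⟨v, hv, rfl⟩, rfl⟩
      exact ⟨_, ⟨u, hu, v, hv, rfl⟩, by simp⟩

theorem ι_mem_commSeries {n : ℕ} {x : L} (hx : x ∈ (⊤ : LieIdeal F L).centralFiltration (n + 1)) :
    ι F x ∈ commSeries (envIdeal (⊤ : LieIdeal F L)) n := by
  induction n generalizing x with
  | zero => exact ι_mem_envIdeal hx
  | succ n ih =>
    have : ((⊤ : LieIdeal F L).centralFiltration (n + 2)).toSubmodule ≤
        (commSeries (envIdeal (⊤ : LieIdeal F L)) (n + 1)).comap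
          (ι F : L →ₗ⁅F⁆ UniversalEnvelopingAlgebra F L).toLinearMap := by
      rw [LieIdeal.centralFiltration, LieSubmodule.lieIdeal_oper_eq_linear_span',
        Submodule.span_le]
      rintro _ ⟨a, ha, c, hc, rfl⟩
      exact Submodule.subset_span ⟨ι F a, ι_mem_envIdeal ha, ι F c, ih hc, by
        rw [← LieRing.of_associative_ring_bracket, ← LieHom.map_lie]
        rfl⟩
    exact this hx

/-- Modulo ω² an element of ω comes from `L`, and in a commutator each error term gains one extra
factor of ω. -/
theorem commSeries_le (n : ℕ) : commSeries (envIdeal (⊤ : LieIdeal F L)) n ≤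
    ((⊤ : LieIdeal F L).centralFiltration (n + 1)).toSubmodule.map
      (ι F : L →ₗ⁅F⁆ UniversalEnvelopingAlgebra F L).toLinearMap ⊔
      envIdeal (⊤ : LieIdeal F L) ^ (n + 2) := by
  have h0 := envIdeal_le_sup (⊤ : LieIdeal F L)
  rw [← pow_two] at h0
  induction n with
  | zero => exact h0
  | succ n ih =>
    rw [commSeries, Submodule.span_le]
    rintro _ ⟨u, hu, v, hv, rfl⟩
    obtain ⟨_, ⟨x, hx, rfl⟩, u', hu', rfl⟩ := Submodule.mem_sup.1 (h0 hu)
    obtain ⟨_, ⟨y, hy, rfl⟩, v', hv', rfl⟩ := Submodule.mem_sup.1 (ih hv)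
    change (ι F x + u') * (ι F y + v') - (ι F y + v') * (ι F x + u') ∈ _
    have hx' := ι_mem_envIdeal hx
    have hu1 : u' ∈ envIdeal (⊤ : LieIdeal F L) := by
      rw [pow_two] at hu'
      exact envIdeal_mul_le _ _ hu'
    have hy' := ι_mem_envIdeal_pow hy
    have hxy : ⁅x, y⁆ ∈ (⊤ : LieIdeal F L).centralFiltration (n + 2) :=
      LieSubmodule.lie_mem_lie hx hy
    have : (ι F x + u') * (ι F y + v') - (ι F y + v') * (ι F x + u') =
        ι F ⁅x, y⁆ + ((ι F x + u') * v' - v' * (ι F x + u') + (u' * ι F y - ι F y * u')) := by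
      rw [LieHom.map_lie, LieRing.of_associative_ring_bracket]
      noncomm_ring
    rw [this]
    refine Submodule.add_mem_sup ⟨_, hxy, rfl⟩ (add_mem (sub_mem ?_ ?_) (sub_mem ?_ ?_))
    · rw [show n + 1 + 2 = 1 + (n + 2) by omega, pow_add, pow_one]
      exact Submodule.mul_mem_mul (add_mem hx' hu1) hv'
    · rw [show n + 1 + 2 = (n + 2) + 1 by omega, pow_add, pow_one]
      exact Submodule.mul_mem_mul hv' (add_mem hx' hu1)
    · rw [show n + 1 + 2 = 2 + (n + 1) by omega, pow_add]
      exact Submodule.mul_mem_mul hu' hy'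
    · rw [show n + 1 + 2 = (n + 1) + 2 by omega, pow_add]
      exact Submodule.mul_mem_mul hy' hu'

/-- The hypothesis puts the (c+1)-fold commutators of ω in ω^{c+2}, a property that transports to
`H`. Since H ∩ ω^{c+2} = γ_{c+2}(H), the lower central series of `H` is constant from γ_{c+1}(H) on;
residual nilpotence, also transported, makes it zero. -/
theorem centralFiltration_eq_bot_of_algEquiv
    {e : UniversalEnvelopingAlgebra F L ≃ₐ[F] UniversalEnvelopingAlgebra F H}
    (he : ∀ u, augmentation F H (e u) = augmentation F L u) {c : ℕ}
    (hc : (⊤ : LieIdeal F L).centralFiltration (c + 1) = ⊥) :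
    (⊤ : LieIdeal F H).centralFiltration (c + 1) = ⊥ := by
  have hmap := map_envIdeal_top he
  have h1 : commSeries (envIdeal (⊤ : LieIdeal F H)) c ≤ envIdeal (⊤ : LieIdeal F H) ^ (c + 2) := by
    have := commSeries_le (F := F) (L := L) c
    rw [hc, LieSubmodule.bot_toSubmodule, Submodule.map_bot, bot_sup_eq] at this
    rw [← hmap, ← map_commSeries, ← Submodule.map_pow]
    exact Submodule.map_mono this
  have h2 : ∀ n, (⊤ : LieIdeal F H).centralFiltration (c + 1) ≤
      (⊤ : LieIdeal F H).centralFiltration (c + 1 + n) := by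
    intro n
    induction n with
    | zero => exact le_rfl
    | succ n ih =>
      have h3 : (⊤ : LieIdeal F H).centralFiltration (c + 1) ≤
          (⊤ : LieIdeal F H).centralFiltration (c + 2) :=
        fun x hx => ι_mem_envIdeal_pow_iff.1 (h1 (ι_mem_commSeries hx))
      refine h3.trans ?_
      have h4 := LieSubmodule.mono_lie_right (I := (⊤ : LieIdeal F H)) ih
      exact h4.trans (LieIdeal.lie_centralFiltration_le _ _)
  have h5 : ∀ u, (∀ n, u ∈ envIdeal (⊤ : LieIdeal F H) ^ (n + 1)) → u = 0 := by
    rw [← forall_mem_pow_iff_of_map_eq e hmap, ← forall_mem_centralFiltration_iff]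
    intro x hx
    simpa [hc] using hx c
  rw [← forall_mem_centralFiltration_iff] at h5
  rw [eq_bot_iff]
  intro x hx
  refine h5 x fun n => ?_
  rcases le_total n c with h | h
  · exact LieIdeal.centralFiltration_antitone _ (by omega) hx
  · obtain ⟨m, rfl⟩ := Nat.exists_eq_add_of_le h
    rw [show c + m + 1 = c + 1 + m by omega]
    exact h2 m hx

theorem lowerCentralSeries_eq_bot_iff
    (e : UniversalEnvelopingAlgebra F L ≃ₐ[F] UniversalEnvelopingAlgebra F H) (c : ℕ) :
    LieModule.lowerCentralSeries F L L c = ⊥ ↔ LieModule.lowerCentralSeries F H H c = ⊥ := by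
  obtain ⟨f, hf⟩ := exists_augmentation_preserving e
  obtain ⟨g, hg⟩ := exists_augmentation_preserving e.symm
  rw [← LieIdeal.centralFiltration_top, ← LieIdeal.centralFiltration_top]
  exact ⟨centralFiltration_eq_bot_of_algEquiv hf, centralFiltration_eq_bot_of_algEquiv hg⟩

end UniversalEnvelopingAlgebra

/-! ### Generators of nilpotent Lie algebras -/

namespace LieAlgebra

variable {F L : Type*} [Field F] [LieRing L] [LieAlgebra F L]

/-- The span of the brackets of elements of a subspace. -/
def bracketSpan (W : Submodule F L) : Submodule F L :=
  Submodule.map₂ (LieModule.toEnd F L L : L →ₗ[F] Module.End F L) W W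

/-- Modulo the next term of the series, a bracket does not change when its entries are altered by
elements of the n-th term. With W a subalgebra this gives the Nakayama-type statement for
generators; with W finite-dimensional it gives finiteness of `L`. -/
theorem sup_bracketSpan_eq_top {W : Submodule F L}
    (h1 : W ⊔ (LieModule.lowerCentralSeries F L L 1).toSubmodule = ⊤) {n : ℕ}
    {V : Submodule F L} (h : V ⊔ (LieModule.lowerCentralSeries F L L n).toSubmodule = ⊤) :
    W ⊔ bracketSpan V ⊔ (LieModule.lowerCentralSeries F L L (n + 1)).toSubmodule = ⊤ := by
  have hlie : ∀ x : L, ∀ y ∈ LieModule.lowerCentralSeries F L L n,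
      ⁅x, y⁆ ∈ LieModule.lowerCentralSeries F L L (n + 1) := fun x y hy => by
    rw [LieModule.lowerCentralSeries_succ]
    exact LieSubmodule.lie_mem_lie (LieSubmodule.mem_top x) hy
  have key : (LieModule.lowerCentralSeries F L L 1).toSubmodule ≤
      bracketSpan V ⊔ (LieModule.lowerCentralSeries F L L (n + 1)).toSubmodule := by
    rw [LieModule.lowerCentralSeries_succ, LieSubmodule.lieIdeal_oper_eq_linear_span',
      Submodule.span_le]
    rintro _ ⟨x, -, y, -, rfl⟩
    obtain ⟨v, hv, g, hg, rfl⟩ := Submodule.mem_sup.1 (h ▸ Submodule.mem_top : x ∈ V ⊔ _)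
    obtain ⟨v', hv', g', hg', rfl⟩ := Submodule.mem_sup.1 (h ▸ Submodule.mem_top : y ∈ V ⊔ _)
    have : ⁅v + g, v' + g'⁆ = ⁅v, v'⁆ + (⁅v + g, g'⁆ - ⁅v', g⁆) := by
      rw [← lie_skew v' g, add_lie, lie_add, lie_add, add_lie]
      abel
    rw [this]
    exact Submodule.add_mem_sup (Submodule.apply_mem_map₂ _ hv hv')
      (sub_mem (hlie _ _ hg') (hlie _ _ hg))
  rw [eq_top_iff, ← h1, sup_assoc]
  exact sup_le_sup_left key W

theorem eq_top_of_sup_lowerCentralSeries_one_eq_top {c : ℕ}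
    (hc : LieModule.lowerCentralSeries F L L c = ⊥) {K : LieSubalgebra F L}
    (h1 : K.toSubmodule ⊔ (LieModule.lowerCentralSeries F L L 1).toSubmodule = ⊤) : K = ⊤ := by
  have hK : bracketSpan K.toSubmodule ≤ K.toSubmodule :=
    Submodule.map₂_le.2 fun x hx y hy => K.lie_mem hx hy
  have key : ∀ n, K.toSubmodule ⊔ (LieModule.lowerCentralSeries F L L n).toSubmodule = ⊤ := by
    intro n
    induction n with
    | zero => simp
    | succ n ih =>
      have := sup_bracketSpan_eq_top h1 ih
      rwa [sup_eq_left.2 hK] at this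
  have := key c
  rw [hc, LieSubmodule.bot_toSubmodule, sup_bot_eq] at this
  rwa [← LieSubalgebra.toSubmodule_inj]

theorem finite_of_fg_sup_lowerCentralSeries_one_eq_top {c : ℕ}
    (hc : LieModule.lowerCentralSeries F L L c = ⊥) {W : Submodule F L} (hW : W.FG)
    (h1 : W ⊔ (LieModule.lowerCentralSeries F L L 1).toSubmodule = ⊤) : Module.Finite F L := by
  have key : ∀ n, ∃ V : Submodule F L, V.FG ∧
      V ⊔ (LieModule.lowerCentralSeries F L L n).toSubmodule = ⊤ := by
    intro n
    induction n with
    | zero => exact ⟨⊥, Submodule.fg_bot, by simp⟩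
    | succ n ih =>
      obtain ⟨V, hV, h⟩ := ih
      exact ⟨W ⊔ bracketSpan V, hW.sup (hV.map₂ _ hV), sup_bracketSpan_eq_top h1 h⟩
  obtain ⟨V, hV, h⟩ := key c
  rw [hc, LieSubmodule.bot_toSubmodule, sup_bot_eq] at h
  exact ⟨h ▸ hV⟩

theorem span_sup_lowerCentralSeries_one_eq_top {S : Set L} (hS : LieSubalgebra.lieSpan F L S = ⊤) :
    Submodule.span F S ⊔ (LieModule.lowerCentralSeries F L L 1).toSubmodule = ⊤ := by
  let K : LieSubalgebra F L :=
    { Submodule.span F S ⊔ (LieModule.lowerCentralSeries F L L 1).toSubmodule with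
      lie_mem' := fun {x y} _ _ => by
        refine Submodule.mem_sup_right (T := (LieModule.lowerCentralSeries F L L 1).toSubmodule) ?_
        rw [LieModule.lowerCentralSeries_succ]
        exact LieSubmodule.lie_mem_lie (LieSubmodule.mem_top x) (LieSubmodule.mem_top y) }
  have hK : LieSubalgebra.lieSpan F L S ≤ K :=
    LieSubalgebra.lieSpan_le.2 fun x hx => Submodule.mem_sup_left (Submodule.subset_span hx)
  rw [hS] at hK
  exact eq_top_iff.2 fun x _ => hK (LieSubalgebra.mem_top x)

/-- A set generates the nilpotent `L` iff its image spans L/L'; lifting a basis of L/L' injectively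
attains the bound. -/
theorem lieGeneratorRank_eq_rank {c : ℕ} (hc : LieModule.lowerCentralSeries F L L c = ⊥) :
    lieGeneratorRank F L = Module.rank F (L ⧸ lieDerived F L) := by
  have hder : lieDerived F L = LieModule.lowerCentralSeries F L L 1 := rfl
  let q : L →ₗ[F] L ⧸ lieDerived F L := (lieDerived F L).toSubmodule.mkQ
  have hq : Function.Surjective q := Submodule.mkQ_surjective _
  have hker : q.ker = (LieModule.lowerCentralSeries F L L 1).toSubmodule := Submodule.ker_mkQ _
  apply le_antisymm
  · let b := Module.Basis.ofVectorSpace F (L ⧸ lieDerived F L)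
    let s : _ → L := fun i => Function.surjInv hq (b i)
    have hs : ∀ i, q (s i) = b i := fun i => Function.surjInv_eq hq _
    have hsinj : Function.Injective s := fun i j h => b.injective (by rw [← hs, ← hs, h])
    rw [← b.mk_eq_rank'', ← Cardinal.mk_range_eq s hsinj]
    refine csInf_le' ⟨Set.range s, ?_, rfl⟩
    refine eq_top_of_sup_lowerCentralSeries_one_eq_top hc ?_
    rw [eq_top_iff, ← hker]
    have h1 : (Submodule.span F (Set.range s)).map q = ⊤ := by
      rw [Submodule.map_span, ← Set.range_comp, show q ∘ s = b from funext hs, b.span_eq]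
    have h2 : Submodule.span F (Set.range s) ⊔ q.ker = ⊤ := by
      rw [← Submodule.comap_map_eq, h1, Submodule.comap_top]
    rw [← h2]
    exact sup_le_sup_right LieSubalgebra.submodule_span_le_lieSpan _
  · refine le_csInf ⟨_, ⊤, ?_, rfl⟩ ?_
    · exact eq_top_iff.2 fun x _ => LieSubalgebra.subset_lieSpan trivial
    · rintro _ ⟨S, hS, rfl⟩
      have h1 : Submodule.span F (q '' S) = ⊤ := by
        have h2 := congrArg (Submodule.map q) (span_sup_lowerCentralSeries_one_eq_top hS)
        rw [Submodule.map_sup, ← hker, (LinearMap.le_ker_iff_map (p := q.ker)).1 le_rfl, sup_bot_eq,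
          Submodule.map_span, Submodule.map_top, LinearMap.range_eq_top.2 hq] at h2
        exact h2
      rw [← rank_top F (L ⧸ lieDerived F L), ← h1]
      exact (rank_span_le _).trans Cardinal.mk_image_le

end LieAlgebra

namespace UniversalEnvelopingAlgebra

attribute [local instance] LieRing.ofAssociativeRing

variable {F L H : Type*} [Field F] [LieRing L] [LieAlgebra F L] [LieRing H] [LieAlgebra F H]

theorem nonempty_abelianization_equiv_envIdealQuotient (F L : Type*) [Field F] [LieRing L]
    [LieAlgebra F L] :
    Nonempty ((L ⧸ lieDerived F L) ≃ₗ[F] EnvIdealQuotient (⊤ : LieIdeal F L)) := by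
  let t : L →ₗ[F] (⊤ : LieIdeal F L) :=
    LinearMap.codRestrict (⊤ : LieIdeal F L).toSubmodule LinearMap.id
      fun x => LieSubmodule.mem_top x
  have hker : (lieDerived F L).toSubmodule = (toEnvIdealQuotient (⊤ : LieIdeal F L) ∘ₗ t).ker := by
    ext x
    exact (toEnvIdealQuotient_eq_zero (x := t x)).symm
  refine ⟨(Submodule.quotEquivOfEq _ _ hker).trans
    ((toEnvIdealQuotient (⊤ : LieIdeal F L) ∘ₗ t).quotKerEquivOfSurjective ?_)⟩
  exact (toEnvIdealQuotient_surjective _).comp fun x => ⟨x, rfl⟩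

theorem nonempty_abelianization_equiv
    {e : UniversalEnvelopingAlgebra F L ≃ₐ[F] UniversalEnvelopingAlgebra F H}
    (he : ∀ u, augmentation F H (e u) = augmentation F L u) :
    Nonempty ((L ⧸ lieDerived F L) ≃ₗ[F] H ⧸ lieDerived F H) := by
  obtain ⟨f⟩ := nonempty_envIdealQuotient_equiv e (map_envIdeal_top he) (map_envIdeal_top he)
  obtain ⟨g⟩ := nonempty_abelianization_equiv_envIdealQuotient F L
  obtain ⟨k⟩ := nonempty_abelianization_equiv_envIdealQuotient F H
  exact ⟨(g.trans f).trans k.symm⟩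

end UniversalEnvelopingAlgebra

/-! ### Growth of the enveloping algebra and invariance of dimension -/

namespace PBW

open Finsupp Module UniversalEnvelopingAlgebra

attribute [local instance] LieRing.ofAssociativeRing

variable {F L I : Type*} [Field F] [LieRing L] [LieAlgebra F L]

/-- A monomial of degree at most n in d variables is determined by d exponents, each at most n. -/
theorem finrank_filt_le (F : Type*) [Field F] (d n : ℕ) :
    Module.Finite F (filt F (0 : Fin d → ℕ) n 0) ∧
      finrank F (filt F (0 : Fin d → ℕ) n 0) ≤ (n + 1) ^ d := by
  let s : Set (Multiset (Fin d)) := {Q | Q.card ≤ n ∧ 0 ≤ (Q.map (0 : Fin d → ℕ)).sum}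
  let f : s → Fin d → Fin (n + 1) := fun Q i =>
    ⟨Q.1.count i, Nat.lt_succ_of_le ((Multiset.count_le_card i Q.1).trans Q.2.1)⟩
  have hf : Function.Injective f := fun Q Q' h => Subtype.ext <| Multiset.ext.2 fun i =>
    congrArg Fin.val (congrFun h i)
  have : Finite s := Finite.of_injective f hf
  have : Fintype s := Fintype.ofFinite s
  let e : filt F (0 : Fin d → ℕ) n 0 ≃ₗ[F] (s →₀ F) := supportedEquivFinsupp s
  refine ⟨Module.Finite.equiv e.symm, ?_⟩
  rw [e.finrank_eq, Module.finrank_finsupp_self]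
  exact (Fintype.card_le_of_injective f hf).trans (by simp)

variable [LinearOrder I]

/-- The elements of degree at most `n` of the enveloping algebra. -/
noncomputable def degLE (b : Basis I F L) (n : ℕ) : Submodule F (UniversalEnvelopingAlgebra F L) :=
  (filt F (0 : I → ℕ) n 0).comap (pbw b).toLinearMap

theorem mem_degLE {b : Basis I F L} {n : ℕ} {u : UniversalEnvelopingAlgebra F L} :
    u ∈ degLE b n ↔ pbw b u ∈ filt F (0 : I → ℕ) n 0 :=
  Iff.rfl

theorem ι_mul_mem_degLE (b : Basis I F L) (x : L) {n : ℕ} {u : UniversalEnvelopingAlgebra F L}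
    (hu : u ∈ degLE b n) : ι F x * u ∈ degLE b (n + 1) := by
  rw [mem_degLE, pbw_ι_mul]
  exact action_mem (isWeight_zero b) (a := 0) (by simp [b.span_eq]) hu

theorem mul_mem_degLE (b : Basis I F L) {m n : ℕ} {u v : UniversalEnvelopingAlgebra F L}
    (hu : u ∈ degLE b m) (hv : v ∈ degLE b n) : u * v ∈ degLE b (m + n) := by
  have h1 : ∀ Q : Multiset I, sortedProd b Q * v ∈ degLE b (Q.card + n) := by
    intro Q
    induction hQ : Q.card generalizing Q with
    | zero =>
      obtain rfl : Q = 0 := by simpa using hQ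
      simpa [sortedProd] using hv
    | succ k ih =>
      rcases eq_zero_or_eq_min_cons Q with rfl | ⟨i, N, rfl, hk⟩
      · simp at hQ
      · rw [sortedProd_cons b hk, mul_assoc, add_right_comm]
        exact ι_mul_mem_degLE b _ (ih N (by simpa using hQ))
  have h2 : filt F (0 : I → ℕ) m 0 ≤
      ((degLE b (m + n)).comap (LinearMap.mulRight F v)).comap (pbw b).symm.toLinearMap := by
    refine filt_induction fun Q hQ _ => ?_
    change (pbw b).symm (mono F Q) * v ∈ degLE b (m + n)
    rw [pbw_symm_mono]
    exact filt_mono (by omega) le_rfl (h1 Q)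
  have h3 := h2 hu
  change (pbw b).symm (pbw b u) * v ∈ degLE b (m + n) at h3
  rwa [LinearEquiv.symm_apply_apply] at h3

theorem exists_mem_degLE (b : Basis I F L) (u : UniversalEnvelopingAlgebra F L) :
    ∃ n, u ∈ degLE b n :=
  mem_filt_zero _ _ _ fun _ _ => Nat.zero_le _

theorem one_mem_degLE (b : Basis I F L) : (1 : UniversalEnvelopingAlgebra F L) ∈ degLE b 0 := by
  rw [mem_degLE, pbw_one]
  exact mono_mem_filt.2 ⟨by simp, Nat.zero_le _⟩

theorem map_list_prod_mem_degLE (b : Basis I F L) {k : ℕ} (l : List (UniversalEnvelopingAlgebra F L))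
    (h : ∀ u ∈ l, u ∈ degLE b k) : l.prod ∈ degLE b (k * l.length) := by
  induction l with
  | nil => simpa using one_mem_degLE b
  | cons u l ih =>
    rw [List.prod_cons, List.length_cons, mul_add, mul_one, add_comm]
    exact mul_mem_degLE b (h u (by simp)) (ih fun v hv => h v (by simp [hv]))

end PBW

namespace UniversalEnvelopingAlgebra

open PBW Module

variable {F L H : Type*} [Field F] [LieRing L] [LieAlgebra F L] [LieRing H] [LieAlgebra F H]

/-- Growth comparison. The preimages of the vectors indexed by T have degree at most some k, so the
(m+1)^|T| independent ordered monomials with exponents at most m land in degree at most k|T|m, a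
space whose dimension is bounded by a polynomial in m of degree dim L. -/
theorem card_le_finrank [Module.Finite F L]
    (e : UniversalEnvelopingAlgebra F L ≃ₐ[F] UniversalEnvelopingAlgebra F H)
    {J : Type*} [LinearOrder J] (b : Basis J F H) (T : Finset J) : T.card ≤ finrank F L := by
  by_contra! hT
  let b₀ := Module.finBasis F L
  choose deg hdeg using fun i : J => exists_mem_degLE b₀ (e.symm (ι F (b i)))
  let k := T.sup deg
  have hk : ∀ i ∈ T, e.symm (ι F (b i)) ∈ degLE b₀ k := fun i hi =>
    filt_mono (Finset.le_sup (f := deg) hi) le_rfl (hdeg i)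
  have hcard : ∀ m : ℕ, (m + 1) ^ T.card ≤ (k * (T.card * m) + 1) ^ finrank F L := by
    intro m
    let ms : (T → Fin (m + 1)) → Multiset J := fun a => ∑ i : T, Multiset.replicate (a i) (i : J)
    have hcount : ∀ a (i : T), (ms a).count (i : J) = a i := by
      intro a i
      simp only [ms, Multiset.count_sum', Multiset.count_replicate]
      rw [Finset.sum_eq_single i]
      · simp
      · intro j _ hj
        rw [if_neg fun h => hj (Subtype.ext h)]
      · simp
    have hms : Function.Injective ms := fun a a' h => funext fun i => Fin.ext <| by
      rw [← hcount, ← hcount, h]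
    have hmem : ∀ a, ∀ i ∈ ms a, i ∈ T := by
      intro a i hi
      simp only [ms, Multiset.mem_sum] at hi
      obtain ⟨j, -, hj⟩ := hi
      rw [Multiset.eq_of_mem_replicate hj]
      exact j.2
    have hmc : ∀ a, (ms a).card ≤ T.card * m := by
      intro a
      simp only [ms, Multiset.card_sum, Multiset.card_replicate]
      refine (Finset.sum_le_card_nsmul _ _ m fun i _ => Nat.le_of_lt_succ (a i).2).trans ?_
      simp
    let v : (T → Fin (m + 1)) → UniversalEnvelopingAlgebra F L := fun a =>
      e.symm (sortedProd b (ms a))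
    have hv : LinearIndependent F v := by
      have h1 : LinearIndependent F fun Q : Multiset J => (mono F Q : Multiset J →₀ F) := by
        simpa using (Finsupp.basisSingleOne (R := F) (ι := Multiset J)).linearIndependent
      have h2 := ((h1.comp ms hms).map' (pbw b).symm.toLinearMap (pbw b).symm.ker).map'
        e.symm.toLinearMap (LinearMap.ker_eq_bot.2 e.symm.injective)
      have hveq : v = e.symm.toLinearMap ∘ (pbw b).symm ∘ (fun Q => mono F Q) ∘ ms :=
        funext fun a => congrArg e.symm (pbw_symm_mono b (ms a)).symm
      rw [hveq]
      exact h2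
    have hvmem : ∀ a, pbw b₀ (v a) ∈ filt F (0 : Fin (finrank F L) → ℕ) (k * (T.card * m)) 0 := by
      intro a
      have h1 : v a ∈ degLE b₀ (k * (ms a).card) := by
        have h2 := map_list_prod_mem_degLE b₀ (k := k)
          (((ms a).sort (· ≤ ·)).map fun i => e.symm (ι F (b i))) (by
            intro u hu
            obtain ⟨i, hi, rfl⟩ := List.mem_map.1 hu
            exact hk i (hmem a i ((Multiset.mem_sort _).1 hi)))
        rw [List.length_map, Multiset.length_sort] at h2
        convert h2 using 1
        simp only [v, sortedProd, map_list_prod, List.map_map]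
        rfl
      exact filt_mono (Nat.mul_le_mul_left k (hmc a)) le_rfl h1
    obtain ⟨hfin, hle⟩ := finrank_filt_le F (finrank F L) (k * (T.card * m))
    have h3 : LinearIndependent F fun a =>
        (⟨pbw b₀ (v a), hvmem a⟩ : filt F (0 : Fin (finrank F L) → ℕ) (k * (T.card * m)) 0) := by
      refine LinearIndependent.of_comp (Submodule.subtype _) ?_
      exact hv.map' (pbw b₀).toLinearMap (pbw b₀).ker
    have h4 := h3.fintype_card_le_finrank
    refine le_trans ?_ (h4.trans hle)
    simp
  set K := k * T.card
  set d := finrank F L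
  -- The value m = (K+1)^d turns the bound ((K+1)(m+1))^d into m(m+1)^d, which is less than
  -- (m+1)^(d+1).
  have h1 := hcard ((K + 1) ^ d)
  set m := (K + 1) ^ d
  have h2 : k * (T.card * m) + 1 ≤ (K + 1) * (m + 1) := by
    have : k * (T.card * m) = K * m := by rw [← mul_assoc]
    rw [this]
    nlinarith
  have h3 : (m + 1) ^ (d + 1) ≤ m * (m + 1) ^ d := by
    calc (m + 1) ^ (d + 1) ≤ (m + 1) ^ T.card := Nat.pow_le_pow_right (by omega) hT
      _ ≤ _ := h1
      _ ≤ ((K + 1) * (m + 1)) ^ d := Nat.pow_le_pow_left h2 d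
      _ = m * (m + 1) ^ d := by rw [mul_pow]
  rw [pow_succ, mul_comm] at h3
  have := Nat.le_of_mul_le_mul_right h3 (by positivity)
  omega

theorem finite_and_finrank_le [Module.Finite F L]
    (e : UniversalEnvelopingAlgebra F L ≃ₐ[F] UniversalEnvelopingAlgebra F H) :
    Module.Finite F H ∧ finrank F H ≤ finrank F L := by
  classical
  let b := Module.Basis.ofVectorSpace F H
  let _ : LinearOrder (Module.Basis.ofVectorSpaceIndex F H) := linearOrderOfSTO WellOrderingRel
  have h := card_le_finrank e b
  have hfin : Finite (Module.Basis.ofVectorSpaceIndex F H) := by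
    by_contra hinf
    rw [not_finite_iff_infinite] at hinf
    obtain ⟨T, hT⟩ := Infinite.exists_subset_card_eq (Module.Basis.ofVectorSpaceIndex F H)
      (finrank F L + 1)
    have := h T
    omega
  have : Fintype (Module.Basis.ofVectorSpaceIndex F H) := Fintype.ofFinite _
  refine ⟨Module.Finite.of_basis b, ?_⟩
  rw [Module.finrank_eq_card_basis b]
  exact h Finset.univ

theorem finrank_eq [Module.Finite F L]
    (e : UniversalEnvelopingAlgebra F L ≃ₐ[F] UniversalEnvelopingAlgebra F H) :
    finrank F L = finrank F H := by
  obtain ⟨_, h⟩ := finite_and_finrank_le e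
  exact le_antisymm (finite_and_finrank_le e.symm).2 h

end UniversalEnvelopingAlgebra

/-! ### Free nilpotent Lie algebras -/

namespace LieAlgebra

variable {F L L' : Type*} [Field F] [LieRing L] [LieAlgebra F L] [LieRing L'] [LieAlgebra F L']

theorem lieSpan_image_eq_top {f : L →ₗ⁅F⁆ L'} (hf : Function.Surjective f) {S : Set L}
    (hS : LieSubalgebra.lieSpan F L S = ⊤) : LieSubalgebra.lieSpan F L' (f '' S) = ⊤ := by
  have h : LieSubalgebra.lieSpan F L S ≤ (LieSubalgebra.lieSpan F L' (f '' S)).comap f :=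
    LieSubalgebra.lieSpan_le.2 fun x hx => LieSubalgebra.subset_lieSpan ⟨x, hx, rfl⟩
  rw [hS] at h
  rw [eq_top_iff]
  intro y _
  obtain ⟨x, rfl⟩ := hf y
  exact h (LieSubalgebra.mem_top x)

theorem _root_.FreeLieAlgebra.lieSpan_range_of (F X : Type*) [Field F] :
    LieSubalgebra.lieSpan F (FreeLieAlgebra F X) (Set.range (FreeLieAlgebra.of F)) = ⊤ := by
  let K := LieSubalgebra.lieSpan F (FreeLieAlgebra F X) (Set.range (FreeLieAlgebra.of F))
  let f : FreeLieAlgebra F X →ₗ⁅F⁆ K := FreeLieAlgebra.lift F fun x =>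
    ⟨FreeLieAlgebra.of F x, LieSubalgebra.subset_lieSpan ⟨x, rfl⟩⟩
  have h : K.incl.comp f = LieHom.id := FreeLieAlgebra.hom_ext fun x => by
    simp [f, FreeLieAlgebra.lift_of_apply]
  rw [eq_top_iff]
  intro x _
  have := LieHom.congr_fun h x
  rw [LieHom.comp_apply, LieHom.id_apply] at this
  rw [← this]
  exact (f x).2

theorem lowerCentralSeries_eq_bot_of_surjective {f : L →ₗ⁅F⁆ L'} (hf : Function.Surjective f)
    {c : ℕ} (h : ∀ x ∈ LieModule.lowerCentralSeries F L L c, f x = 0) :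
    LieModule.lowerCentralSeries F L' L' c = ⊥ := by
  rw [← LieIdeal.lowerCentralSeries_map_eq c hf, LieIdeal.map_eq_bot_iff]
  exact fun x hx => LieHom.mem_ker.2 (h x hx)

theorem derivedSeries_eq_lie (k : ℕ) : derivedSeries F L (k + 1) =
    ⁅derivedSeries F L k, derivedSeries F L k⁆ :=
  derivedSeriesOfIdeal_succ F L ⊤ k

end LieAlgebra

namespace UniversalEnvelopingAlgebra

open Module

attribute [local instance] LieRing.ofAssociativeRing

variable {F : Type*} [Field F]

theorem lift_lieGeneratorRank_eq {L : Type u} [LieRing L] [LieAlgebra F L] {H : Type v} [LieRing H]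
    [LieAlgebra F H] (e : UniversalEnvelopingAlgebra F L ≃ₐ[F] UniversalEnvelopingAlgebra F H)
    {c : ℕ} (hc : LieModule.lowerCentralSeries F L L c = ⊥) :
    Cardinal.lift.{v} (lieGeneratorRank F L) = Cardinal.lift.{u} (lieGeneratorRank F H) := by
  obtain ⟨e', he'⟩ := exists_augmentation_preserving e
  obtain ⟨f⟩ := nonempty_abelianization_equiv he'
  rw [LieAlgebra.lieGeneratorRank_eq_rank hc,
    LieAlgebra.lieGeneratorRank_eq_rank ((lowerCentralSeries_eq_bot_iff e c).1 hc)]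
  exact f.lift_rank_eq

theorem exists_generators_of_lift_lieGeneratorRank_le {H : Type v} [LieRing H] [LieAlgebra F H]
    {n : ℕ} (h : lieGeneratorRank F H ≤ n) :
    ∃ g : Fin n → H, LieSubalgebra.lieSpan F H (Set.range g) = ⊤ := by
  obtain ⟨S, hS, hcard⟩ : lieGeneratorRank F H ∈
      {κ | ∃ S : Set H, LieSubalgebra.lieSpan F H S = ⊤ ∧ Cardinal.mk S = κ} :=
    csInf_mem ⟨_, ⊤, eq_top_iff.2 fun x _ => LieSubalgebra.subset_lieSpan trivial, rfl⟩
  have hle : Cardinal.lift.{0} (Cardinal.mk S) ≤ Cardinal.lift.{v} (Cardinal.mk (Fin n)) := by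
    simpa [hcard] using h
  obtain ⟨i⟩ := Cardinal.lift_mk_le'.1 hle
  -- There may be fewer than n generators; the unused indices are sent to 0.
  refine ⟨Function.extend i Subtype.val 0, ?_⟩
  rw [eq_top_iff, ← hS]
  refine LieSubalgebra.lieSpan_mono fun x hx => ⟨i ⟨x, hx⟩, ?_⟩
  rw [i.injective.extend_apply]

/-- `H` has at most n generators and satisfies the same nilpotence bound, so the free Lie algebra
maps onto it through `L`. Both have the same finite dimension, hence the surjection L → H is
bijective. -/
theorem nonempty_lieEquiv_of_isFGFreeNilpotent {L : Type u} [LieRing L] [LieAlgebra F L]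
    {H : Type v} [LieRing H] [LieAlgebra F H]
    (e : UniversalEnvelopingAlgebra F L ≃ₐ[F] UniversalEnvelopingAlgebra F H)
    (hL : IsFGFreeNilpotent F L) : Nonempty (L ≃ₗ⁅F⁆ H) := by
  obtain ⟨n, c, ⟨t⟩⟩ := hL
  let N : LieIdeal F (FreeLieAlgebra F (Fin n)) :=
    LieModule.lowerCentralSeries F (FreeLieAlgebra F (Fin n)) (FreeLieAlgebra F (Fin n)) c
  let q : FreeLieAlgebra F (Fin n) →ₗ⁅F⁆ L := (t.symm : _ →ₗ⁅F⁆ L).comp N.mkHom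
  have hq : Function.Surjective q := t.symm.surjective.comp N.mkHom_surjective
  have hqN : ∀ x ∈ N, q x = 0 := fun x hx => by
    have h1 : N.mkHom x = 0 := LieIdeal.mkHom_eq_zero.2 hx
    change t.symm (N.mkHom x) = 0
    rw [h1]
    exact map_zero t.symm.toLinearEquiv
  have hc : LieModule.lowerCentralSeries F L L c = ⊥ :=
    LieAlgebra.lowerCentralSeries_eq_bot_of_surjective hq hqN
  have hcH := (lowerCentralSeries_eq_bot_iff e c).1 hc
  have hgen := LieAlgebra.lieSpan_image_eq_top hq (FreeLieAlgebra.lieSpan_range_of F (Fin n))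
  have hfin : Module.Finite F L := by
    refine LieAlgebra.finite_of_fg_sup_lowerCentralSeries_one_eq_top hc
      (W := Submodule.span F (q '' Set.range (FreeLieAlgebra.of F)))
      (Submodule.fg_span ((Set.finite_range _).image _))
      (LieAlgebra.span_sup_lowerCentralSeries_one_eq_top hgen)
  have hrankL : lieGeneratorRank F L ≤ n := by
    have h0 : lieGeneratorRank F L ≤ Cardinal.mk (q '' Set.range (FreeLieAlgebra.of F)) :=
      csInf_le' ⟨_, hgen, rfl⟩
    refine h0.trans ?_
    rw [← Set.range_comp]
    have := Cardinal.mk_range_le_lift (f := (q ∘ FreeLieAlgebra.of F : Fin n → L))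
    simpa using this
  have hrankH : lieGeneratorRank F H ≤ n := by
    have h1 := Cardinal.lift_le.{v}.2 hrankL
    rw [lift_lieGeneratorRank_eq e hc] at h1
    simpa using h1
  obtain ⟨g, hg⟩ := exists_generators_of_lift_lieGeneratorRank_le hrankH
  let p : FreeLieAlgebra F (Fin n) →ₗ⁅F⁆ H := FreeLieAlgebra.lift F g
  have hpN : ∀ x ∈ N, p x = 0 := fun x hx => by
    have h1 := LieIdeal.map_lowerCentralSeries_le c (f := p) (LieIdeal.mem_map hx)
    rwa [hcH, LieSubmodule.mem_bot] at h1
  have hp : Function.Surjective p := by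
    have h1 : LieSubalgebra.lieSpan F H (Set.range g) ≤ p.range := by
      refine LieSubalgebra.lieSpan_le.2 ?_
      rintro _ ⟨i, rfl⟩
      exact ⟨FreeLieAlgebra.of F i, FreeLieAlgebra.lift_of_apply g i⟩
    rw [hg] at h1
    exact fun y => h1 (LieSubalgebra.mem_top y)
  let f : L →ₗ⁅F⁆ H := (N.liftHom p hpN).comp (t : L →ₗ⁅F⁆ _)
  have hf : Function.Surjective f := by
    intro y
    obtain ⟨x, rfl⟩ := hp y
    refine ⟨t.symm (N.mkHom x), ?_⟩
    change N.liftHom p hpN (t (t.symm (N.mkHom x))) = p x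
    rw [LieEquiv.apply_symm_apply]
    rfl
  have := (finite_and_finrank_le e).1
  have hinj : Function.Injective f :=
    (LinearMap.injective_iff_surjective_of_finrank_eq_finrank (f := (f : L →ₗ[F] H))
      (finrank_eq e)).2 hf
  exact ⟨LieEquiv.ofBijective f ⟨hinj, hf⟩⟩

/-! ### Solvability through idempotent subspaces -/

section Solvable

variable {L H : Type*} [LieRing L] [LieAlgebra F L] [LieRing H] [LieAlgebra F H]

/-- Idempotence places `I` in every power of `envIdeal N`. In U(L/[N,N]) the image of N is abelian,
so these powers intersect in zero and `I` dies there. Iterating along the derived series kills `I`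
when `L` is solvable. -/
theorem le_envIdeal_lie_of_idempotent {I : Submodule F (UniversalEnvelopingAlgebra F L)}
    (hI : I ≤ I * I) {N : LieIdeal F L} (hN : I ≤ envIdeal N) : I ≤ envIdeal ⁅N, N⁆ := by
  intro u hu
  have hpow : ∀ n, I ≤ envIdeal N ^ (n + 1) := by
    intro n
    induction n with
    | zero => simpa using hN
    | succ n ih =>
      rw [pow_succ]
      exact hI.trans (mul_le_mul' ih hN)
  refine mem_envIdeal_of_map_mkHom_eq_zero ?_
  let f := (⁅N, N⁆ : LieIdeal F L).mkHom
  refine eq_zero_of_forall_mem_envIdeal_pow_of_nilpotent (N := N.map f) (c := 2) ?_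
    fun n => map_mem_envIdeal_pow f (fun x hx => LieIdeal.mem_map hx) (hpow n hu)
  exact N.map_mkHom_centralFiltration 2

theorem eq_bot_of_idempotent_of_isSolvable (hL : LieAlgebra.IsSolvable L)
    {I : Submodule F (UniversalEnvelopingAlgebra F L)}
    (hI : I ≤ I * I) (htop : I ≤ envIdeal (⊤ : LieIdeal F L)) : I = ⊥ := by
  have key : ∀ k, I ≤ envIdeal (LieAlgebra.derivedSeries F L k) := by
    intro k
    induction k with
    | zero => exact htop
    | succ k ih =>
      rw [LieAlgebra.derivedSeries_eq_lie]
      exact le_envIdeal_lie_of_idempotent hI ih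
  obtain ⟨k, hk⟩ := (LieAlgebra.isSolvable_iff F L).1 hL
  have hbot : envIdeal (⊥ : LieIdeal F L) = ⊥ := by
    rw [envIdeal, LieSubmodule.bot_toSubmodule, Submodule.map_bot, Submodule.bot_mul]
  rw [eq_bot_iff, ← hbot, ← hk]
  exact key k

/-- In finite dimension the derived series stabilizes at some P = [P,P], nonzero when `L` is not
solvable; writing brackets as commutators makes `envIdeal P` idempotent. -/
theorem exists_idempotent_of_not_isSolvable [Module.Finite F L] (hL : ¬ LieAlgebra.IsSolvable L) :
    ∃ I : Submodule F (UniversalEnvelopingAlgebra F L), I ≤ I * I ∧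
      I ≤ envIdeal (⊤ : LieIdeal F L) ∧ I ≠ ⊥ := by
  obtain ⟨n, hn⟩ := IsArtinian.monotone_stabilizes (R := F) (M := L)
    ⟨fun n => OrderDual.toDual (LieAlgebra.derivedSeries F L n).toSubmodule,
      fun m n h => LieAlgebra.derivedSeriesOfIdeal_antitone ⊤ h⟩
  set P := LieAlgebra.derivedSeries F L n with hP
  have hPP : P = ⁅P, P⁆ := by
    have h1 : P.toSubmodule = (LieAlgebra.derivedSeries F L (n + 1)).toSubmodule :=
      hn (n + 1) (by omega)
    have h2 : P = LieAlgebra.derivedSeries F L (n + 1) := LieSubmodule.toSubmodule_injective h1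
    rwa [LieAlgebra.derivedSeries_eq_lie, ← hP] at h2
  refine ⟨envIdeal P, ?_, envIdeal_mono le_top, fun h => hL ?_⟩
  · have h1 : P.toSubmodule ≤ (envIdeal P * envIdeal P).comap
        (ι F : L →ₗ⁅F⁆ UniversalEnvelopingAlgebra F L).toLinearMap := by
      conv_lhs => rw [hPP]
      rw [LieSubmodule.lieIdeal_oper_eq_linear_span', Submodule.span_le]
      rintro _ ⟨a, ha, c, hc, rfl⟩
      change ι F ⁅a, c⁆ ∈ envIdeal P * envIdeal P
      rw [LieHom.map_lie, LieRing.of_associative_ring_bracket]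
      exact sub_mem (Submodule.mul_mem_mul (ι_mem_envIdeal ha) (ι_mem_envIdeal hc))
        (Submodule.mul_mem_mul (ι_mem_envIdeal hc) (ι_mem_envIdeal ha))
    refine envIdeal_le.2 fun x hx u => ?_
    -- The rewriting shows that `envIdeal P * envIdeal P` absorbs multiplication by ⊤ on the right,
    -- so membership of ι(x) suffices.
    rw [← envIdeal_mul_top P, mul_assoc, ← mul_assoc (⊤ : Submodule F _), ← mul_assoc,
      ← mul_assoc, mul_assoc (envIdeal P), top_mul_envIdeal]
    exact Submodule.mul_mem_mul (h1 hx) Submodule.mem_top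
  · refine (LieAlgebra.isSolvable_iff F L).2 ⟨n, ?_⟩
    rw [← hP, eq_bot_iff]
    intro x hx
    have h1 : ι F x ∈ envIdeal P := ι_mem_envIdeal hx
    rw [h, Submodule.mem_bot] at h1
    exact ι_injective (h1.trans (map_zero _).symm)

theorem isSolvable_of_algEquiv [Module.Finite F H]
    {e : UniversalEnvelopingAlgebra F L ≃ₐ[F] UniversalEnvelopingAlgebra F H}
    (he : ∀ u, augmentation F H (e u) = augmentation F L u) (hL : LieAlgebra.IsSolvable L) :
    LieAlgebra.IsSolvable H := by
  by_contra hH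
  obtain ⟨I, hI, htop, hne⟩ := exists_idempotent_of_not_isSolvable (F := F) hH
  refine hne ?_
  have h1 : I.map e.symm.toAlgHom.toLinearMap = ⊥ := by
    refine eq_bot_of_idempotent_of_isSolvable hL ?_ ?_
    · rw [← Submodule.map_mul]
      exact Submodule.map_mono hI
    · rintro _ ⟨u, hu, rfl⟩
      rw [mem_envIdeal_top, ← he]
      have h2 := mem_envIdeal_top.1 (htop hu)
      simpa using h2
  exact Submodule.map_injective_of_injective (f := e.symm.toAlgHom.toLinearMap) e.symm.injective
    (h1.trans (Submodule.map_bot _).symm)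

end Solvable

end UniversalEnvelopingAlgebra

/-! ### Nilpotence over the base field and the main theorem -/

theorem LieRing.isNilpotent_iff_exists_lowerCentralSeries (F : Type*) {L : Type*} [Field F]
    [LieRing L] [LieAlgebra F L] :
    LieRing.IsNilpotent L ↔ ∃ c, LieModule.lowerCentralSeries F L L c = ⊥ :=
  LieModule.isNilpotent_iff F L L

/-- The nilpotency length is defined through the lower central series over ℤ, whose terms have the
same underlying sets as those over F. -/
theorem LieModule.nilpotencyLength_eq_sInf (F : Type*) {L : Type*} [Field F] [LieRing L]
    [LieAlgebra F L] : LieModule.nilpotencyLength L L =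
      sInf {c | LieModule.lowerCentralSeries F L L c = ⊥} := by
  rw [LieModule.nilpotencyLength]
  congr 1
  ext c
  have h := LieModule.coe_lowerCentralSeries_eq_int F L L c
  simp only [Set.mem_ofPred_eq, SetLike.ext'_iff]
  exact ⟨fun h' => h.trans h', fun h' => h.symm.trans h'⟩

theorem mainTheorem2 {F : Type*} [Field F]
    {L : Type u} [LieRing L] [LieAlgebra F L]
    {H : Type v} [LieRing H] [LieAlgebra F H]
    (hU : Nonempty (UniversalEnvelopingAlgebra F L ≃ₐ[F] UniversalEnvelopingAlgebra F H)) :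
    (LieIsResiduallyNilpotent F L ↔ LieIsResiduallyNilpotent F H) ∧
    (LieRing.IsNilpotent L ↔ LieRing.IsNilpotent H) ∧
    (LieRing.IsNilpotent L →
      LieModule.nilpotencyLength L L = LieModule.nilpotencyLength H H) ∧
    (LieRing.IsNilpotent L →
      Cardinal.lift.{v} (lieGeneratorRank F L) = Cardinal.lift.{u} (lieGeneratorRank F H)) ∧
    (IsFGFreeNilpotent F L → Nonempty (L ≃ₗ⁅F⁆ H)) ∧
    Nonempty (LieDerivedQuotient F L ≃ₗ⁅F⁆ LieDerivedQuotient F H) ∧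
    (LieIsResiduallyNilpotent F (lieDerived F L) ↔
      LieIsResiduallyNilpotent F (lieDerived F H)) ∧
    (Module.Finite F L → (LieAlgebra.IsSolvable L ↔ LieAlgebra.IsSolvable H)) := by
  obtain ⟨e₀⟩ := hU
  obtain ⟨e, he⟩ := UniversalEnvelopingAlgebra.exists_augmentation_preserving e₀
  have hlcs := UniversalEnvelopingAlgebra.lowerCentralSeries_eq_bot_iff e
  refine ⟨?_, ?_, fun _ => ?_, fun hL => ?_, ?_, ?_, ?_, fun _ => ?_⟩
  · rw [UniversalEnvelopingAlgebra.lieIsResiduallyNilpotent_iff,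
      UniversalEnvelopingAlgebra.lieIsResiduallyNilpotent_iff]
    exact UniversalEnvelopingAlgebra.forall_mem_pow_iff_of_map_eq e
      (UniversalEnvelopingAlgebra.map_envIdeal_top he)
  · rw [LieRing.isNilpotent_iff_exists_lowerCentralSeries F,
      LieRing.isNilpotent_iff_exists_lowerCentralSeries F]
    exact exists_congr hlcs
  · rw [LieModule.nilpotencyLength_eq_sInf F, LieModule.nilpotencyLength_eq_sInf F]
    simp only [hlcs]
  · obtain ⟨c, hc⟩ := (LieRing.isNilpotent_iff_exists_lowerCentralSeries F).1 hL
    exact UniversalEnvelopingAlgebra.lift_lieGeneratorRank_eq e hc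
  · exact UniversalEnvelopingAlgebra.nonempty_lieEquiv_of_isFGFreeNilpotent e
  · exact UniversalEnvelopingAlgebra.nonempty_derivedQuotient_equiv he
  · rw [UniversalEnvelopingAlgebra.lieIsResiduallyNilpotent_ideal_iff,
      UniversalEnvelopingAlgebra.lieIsResiduallyNilpotent_ideal_iff]
    exact UniversalEnvelopingAlgebra.forall_mem_pow_iff_of_map_eq e
      (UniversalEnvelopingAlgebra.map_envIdeal_derived e)
  · have := (UniversalEnvelopingAlgebra.finite_and_finrank_le e).1
    refine ⟨UniversalEnvelopingAlgebra.isSolvable_of_algEquiv he,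
      UniversalEnvelopingAlgebra.isSolvable_of_algEquiv (e := e.symm) fun u => ?_⟩
    rw [← he, AlgEquiv.apply_symm_apply]
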